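/- Let $D$ be a connected complex manifold, $\mathcal V\to D$ a Hermitian holomorphic vector bundle of finite rank, and $H$ a Lie group acting on $\mathcal V\to D$ by automorphisms: the action on the total space, $L_h:\mathcal V\to\mathcal V$, covers an action $x\mapsto h\cdot x$ on $D$, both are continuous and every $h\in H$ acts biholomorphically, and the induced maps $L_h:\mathcal V_x\to\mathcal V_{h\cdot x}$ are unitary. The space $\mathcal O(D,\mathcal V)$ of holomorphic sections carries the topology of uniform convergence on compact sets, and $H$ acts on it by $s\mapsto L_h\,s(h^{-1}\cdot\,)$. A unitary representation $\pi$ of $H$ on a Hilbert space $\mathcal H$ is *realized in* $\mathcal O(D,\mathcal V)$ if there is an injective continuous $H$-intertwining linear map $\mathcal H\to\mathcal O(D,\mathcal V)$. A unitary representation is *multiplicity-free* if its ring of continuous intertwining endomorphisms is commutative. Assume the following. 1. (Base space) The $H$-action on $D$ is $S$-visible with a compatible automorphism of $H$: there are a non-empty subset $S\subset D$ such that $D':=H\cdot S$ is open in $D$, an anti-holomorphic diffeomorphism $\sigma$ of $D'$ with $\sigma|_S=\mathrm{id}$ which preserves every $H$-orbit in $D'$, and an automorphism $\tilde\sigma$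 of the group $H$ with $\tilde\sigma(h)\cdot\sigma(y)=\sigma(h\cdot y)$ for all $h\in H$, $y\in D'$. 2. (Fiber) For every $x\in S$ the representation of the isotropy subgroup $H_x=\{h\in H: h\cdot x=x\}$ on $\mathcal V_x$ is multiplicity-free, with irreducible decomposition $\mathcal V_x=\bigoplus_{i=1}^{n(x)}\mathcal V_x^{(i)}$. 3. (Compatibility) $\sigma$ lifts to an anti-holomorphic endomorphism (again denoted $\sigma$) of the $H$-equivariant Hermitian bundle $\mathcal V|_{D'}$, that is, to an anti-holomorphic map of its total space covering $\sigma$ whose fiber maps $\sigma_x:\mathcal V_x\to\mathcal V_{\sigma(x)}$ are conjugate-linear isometries and which satisfies $L_{\tilde\sigma(h)}\circ\sigma=\sigma\circ L_h$ for all $h\in H$; and $\sigma_x(\mathcal V_x^{(i)})=\mathcal V_x^{(i)}$ for all $x\in S$ and $1\le i\le n(x)$. Then every unitary representation of $H$ realized in $\mathcal O(D,\mathcal V)$ is multiplicity-free. -/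

import Mathlib

open Bundle
open scoped Manifold ContDiff

/-! ### Unitary representations -/

section UnitaryRepresentations

/-- A unitary action `ρ` of a group `G` on an inner product space `V` is *multiplicity-free* if
the ring of continuous `G`-intertwining endomorphisms of `V` is commutative. -/
def IsMultiplicityFree {G V : Type*} [Group G] [NormedAddCommGroup V] [InnerProductSpace ℂ V]
    (ρ : G →* (V ≃ₗᵢ[ℂ] V)) : Prop :=
  ∀ A B : V →L[ℂ] V,
    (∀ (g : G) (v : V), A (ρ g v) = ρ g (A v)) →
    (∀ (g : G) (v : V), B (ρ g v) = ρ g (B v)) →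
    A * B = B * A

/-- The subspace `W` is invariant under the unitary action `ρ`. -/
def IsInvariantSubspace {G V : Type*} [Group G] [NormedAddCommGroup V] [InnerProductSpace ℂ V]
    (ρ : G →* (V ≃ₗᵢ[ℂ] V)) (W : Submodule ℂ V) : Prop :=
  ∀ (g : G), ∀ v ∈ W, ρ g v ∈ W

/-- `V = ⨁ i, W i` is a decomposition of `V` into irreducible subrepresentations. -/
structure IsIrreducibleDecomposition {G V ι : Type*} [Group G] [NormedAddCommGroup V]
    [InnerProductSpace ℂ V] [DecidableEq ι] (ρ : G →* (V ≃ₗᵢ[ℂ] V)) (W : ι → Submodule ℂ V) :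
    Prop where
  invariant : ∀ i, IsInvariantSubspace ρ (W i)
  ne_bot : ∀ i, W i ≠ ⊥
  irreducible : ∀ i, ∀ U : Submodule ℂ V, U ≤ W i → IsInvariantSubspace ρ U → U = ⊥ ∨ U = W i
  isInternal : DirectSum.IsInternal W

/-- A unitary representation of a topological group on an inner product space: a homomorphism into
the unitary operators which is strongly continuous. -/
structure UnitaryRep (G V : Type*) [Group G] [TopologicalSpace G] [NormedAddCommGroup V]
    [InnerProductSpace ℂ V] where
  toHom : G →* (V ≃ₗᵢ[ℂ] V)
  continuous_apply : ∀ v : V, Continuous fun g : G => toHom g v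

end UnitaryRepresentations

/-! ### Anti-holomorphic maps -/

/-- A map `f` between complex manifolds is *anti-holomorphic* on `U` if at every point of `U` it is
(real) differentiable with conjugate-linear derivative. The models `I` and `I'` are the underlying
real models; the tangent spaces are identified with the complex model spaces `E`, `E'` by means of
the (holomorphic) preferred charts. -/
def AntiholomorphicOn {E HM M E' HM' M' : Type*}
    [NormedAddCommGroup E] [NormedSpace ℂ E] [NormedSpace ℝ E] [IsScalarTower ℝ ℂ E]
    [TopologicalSpace HM] (I : ModelWithCorners ℝ E HM) [TopologicalSpace M] [ChartedSpace HM M]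
    [NormedAddCommGroup E'] [NormedSpace ℂ E'] [NormedSpace ℝ E'] [IsScalarTower ℝ ℂ E']
    [TopologicalSpace HM'] (I' : ModelWithCorners ℝ E' HM') [TopologicalSpace M']
    [ChartedSpace HM' M'] (f : M → M') (U : Set M) : Prop :=
  ∀ x ∈ U, ∃ A : E →L[ℝ] E', HasMFDerivAt I I' f x A ∧
    ∀ v : E, A (Complex.I • v) = -(Complex.I • A v)

/-! ### Visible actions -/

section Visible

/-- The saturation `H · S` of a subset `S`. -/
def orbitSet (H : Type*) {D : Type*} [Group H] [MulAction H D] (S : Set D) : Set D :=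
  {y | ∃ h : H, ∃ x ∈ S, h • x = y}

variable {ED : Type*} [NormedAddCommGroup ED] [NormedSpace ℂ ED]
  {D : Type*} [TopologicalSpace D] [ChartedSpace ED D]

/-- The action of `H` on `D` is `S`-visible by means of `σ`: the set `D' = H · S` is open, and `σ`
is an anti-holomorphic diffeomorphism of `D'` which is the identity on `S` and preserves every
`H`-orbit in `D'`. -/
structure IsSVisible (H : Type*) [Group H] [MulAction H D] (S : Set D)
    (σ : OpenPartialHomeomorph D D) : Prop where
  isOpen : IsOpen (orbitSet H S)
  source_eq : σ.source = orbitSet H S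
  target_eq : σ.target = orbitSet H S
  antiholomorphic : AntiholomorphicOn 𝓘(ℝ, ED) 𝓘(ℝ, ED) σ (orbitSet H S)
  antiholomorphic_symm : AntiholomorphicOn 𝓘(ℝ, ED) 𝓘(ℝ, ED) σ.symm (orbitSet H S)
  fixes : ∀ x ∈ S, σ x = x
  preserves_orbits : ∀ x ∈ orbitSet H S, σ '' MulAction.orbit H x = MulAction.orbit H x

/-- The group automorphism `τ` of `H` is compatible with `σ` on `D' = H · S`. -/
def IsCompatibleAut {H : Type*} [Group H] [MulAction H D] (S : Set D)
    (σ : OpenPartialHomeomorph D D) (τ : H ≃* H) : Prop :=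
  ∀ (h : H), ∀ y ∈ orbitSet H S, τ h • σ y = σ (h • y)

end Visible

/-! ### Hermitian holomorphic vector bundles and their sections -/

/-- The identification of the fibers over two equal base points. -/
def fiberCast {D : Type*} {E : D → Type*} [∀ x, NormedAddCommGroup (E x)]
    [∀ x, InnerProductSpace ℂ (E x)] {x y : D} (e : x = y) : E x ≃ₗᵢ[ℂ] E y :=
  e ▸ LinearIsometryEquiv.refl ℂ (E x)

theorem mk_fiberCast {D : Type*} (F : Type*) {E : D → Type*} [∀ x, NormedAddCommGroup (E x)]
    [∀ x, InnerProductSpace ℂ (E x)] {x y : D} (e : x = y) (v : E x) :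
    TotalSpace.mk' F y (fiberCast e v) = TotalSpace.mk' F x v := by
  subst e; rfl

section Bundles

variable {ED : Type*} [NormedAddCommGroup ED] [NormedSpace ℂ ED]
  {D : Type*} [TopologicalSpace D] [ChartedSpace ED D]
  {F : Type*} [NormedAddCommGroup F] [NormedSpace ℂ F]
  {E : D → Type*} [∀ x, NormedAddCommGroup (E x)] [∀ x, InnerProductSpace ℂ (E x)]
  [TopologicalSpace (TotalSpace F E)] [FiberBundle F E] [VectorBundle ℂ F E]

variable (ED F E) in
/-- The Hermitian inner products on the fibers depend smoothly on the base point: in every local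
trivialization of the atlas, the inner product of two constant local sections is smooth. -/
def IsSmoothHermitian : Prop :=
  ∀ (e : Trivialization F (π F E)) [MemTrivializationAtlas e] (u v : F),
    ContMDiffOn 𝓘(ℝ, ED) 𝓘(ℝ, ℂ) ∞ (fun x => inner ℂ (e.symm x u) (e.symm x v)) e.baseSet

variable (ED F E) in
/-- The space `𝒪(D, E)` of holomorphic (i.e. complex analytic) sections. -/
abbrev HolSection := Cₛ^ω⟮𝓘(ℂ, ED); F, E⟯

/-- The uniform (extended) distance of two holomorphic sections over a set `K`. -/
noncomputable abbrev HolSection.edistOn (K : Set D) : PseudoEMetricSpace (HolSection ED F E) where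
  edist s t := ⨆ x ∈ K, edist (s x) (t x)
  edist_self s := by simp
  edist_comm s t := by simp only [edist_comm]
  edist_triangle s t u := by
    refine iSup₂_le fun x hx => (edist_triangle (s x) (t x) (u x)).trans ?_
    exact add_le_add (le_iSup₂ (f := fun x (_ : x ∈ K) => edist (s x) (t x)) x hx)
      (le_iSup₂ (f := fun x (_ : x ∈ K) => edist (t x) (u x)) x hx)

/-- The topology of `𝒪(D, E)`: uniform convergence on compact subsets of `D`. -/
noncomputable instance HolSection.instTopologicalSpace : TopologicalSpace (HolSection ED F E) :=
  ⨅ K : {K : Set D // IsCompact K}, (HolSection.edistOn (K : Set D)).toUniformSpace.toTopologicalSpace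

variable (ED F E) in
/-- An action of the topological group `H` on the Hermitian holomorphic vector bundle `E → D` by
automorphisms, lifting the given action on `D`. It is given by unitary maps
`L h x : E x → E (h • x)`; the resulting map `(h, v) ↦ L_h v` is a continuous group action on the
total space, and each `h` acts biholomorphically on the total space and on the base (holomorphy of
the inverse is holomorphy of the action of `h⁻¹`). -/
structure BundleAction (H : Type*) [Group H] [TopologicalSpace H] [MulAction H D] where
  L : ∀ (h : H) (x : D), E x ≃ₗᵢ[ℂ] E (h • x)
  one_act : ∀ (x : D) (v : E x),
    TotalSpace.mk' F ((1 : H) • x) (L 1 x v) = TotalSpace.mk' F x v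
  mul_act : ∀ (g h : H) (x : D) (v : E x),
    TotalSpace.mk' F ((g * h) • x) (L (g * h) x v) =
      TotalSpace.mk' F (g • h • x) (L g (h • x) (L h x v))
  continuous_base : Continuous fun p : H × D => p.1 • p.2
  continuous_total : Continuous fun p : H × TotalSpace F E =>
    TotalSpace.mk' F (p.1 • p.2.proj) (L p.1 p.2.proj p.2.snd)
  holomorphic_base : ∀ h : H, ContMDiff 𝓘(ℂ, ED) 𝓘(ℂ, ED) ω fun x : D => h • x
  holomorphic_total : ∀ h : H, ContMDiff (𝓘(ℂ, ED).prod 𝓘(ℂ, F)) (𝓘(ℂ, ED).prod 𝓘(ℂ, F)) ω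
    fun p : TotalSpace F E => TotalSpace.mk' F (h • p.proj) (L h p.proj p.snd)

namespace BundleAction

variable {H : Type*} [Group H] [TopologicalSpace H] [MulAction H D]

/-- The action of `h : H` on the total space. -/
def total (𝓛 : BundleAction ED F E H) (h : H) (p : TotalSpace F E) : TotalSpace F E :=
  TotalSpace.mk' F (h • p.proj) (𝓛.L h p.proj p.snd)

/-- The unitary representation of the isotropy subgroup `H_x` on the fiber `E x`. -/
def isotropyRep (𝓛 : BundleAction ED F E H) (x : D) :
    MulAction.stabilizer H x →* (E x ≃ₗᵢ[ℂ] E x) where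
  toFun h := (𝓛.L (h : H) x).trans (fiberCast h.2)
  map_one' := by
    ext v
    have := (mk_fiberCast F (1 : MulAction.stabilizer H x).2 (𝓛.L 1 x v)).trans (𝓛.one_act x v)
    exact TotalSpace.mk_injective x this
  map_mul' g h := by
    ext v
    have key : ∀ (y : D) (e : y = x) (w : E y),
        TotalSpace.mk' F ((g : H) • y) (𝓛.L g y w) =
          TotalSpace.mk' F ((g : H) • x) (𝓛.L g x (fiberCast e w)) := by
      intro y e w; subst e; rfl
    refine TotalSpace.mk_injective (F := F) x ?_
    refine (mk_fiberCast F (g * h).2 _).trans ?_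
    refine (𝓛.mul_act g h x v).trans ?_
    refine (key _ h.2 _).trans ?_
    exact (mk_fiberCast F g.2 _).symm

/-- A unitary representation `ρ` of `H` is *realized in* `𝒪(D, E)` if there is an injective
continuous linear map `T` from its space into `𝒪(D, E)` intertwining `ρ` with the pull-back action
`s ↦ L_h s(h⁻¹ · )` on sections; the intertwining property is written at the point `h • x`. -/
def IsRealized (𝓛 : BundleAction ED F E H) {V : Type*} [NormedAddCommGroup V]
    [InnerProductSpace ℂ V] (ρ : UnitaryRep H V) : Prop :=
  ∃ T : V →ₗ[ℂ] HolSection ED F E, Function.Injective T ∧ Continuous T ∧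
    ∀ (h : H) (v : V) (x : D), T (ρ.toHom h v) (h • x) = 𝓛.L h x (T v x)

/-- The map of total spaces over `σ` with the fiber maps `f`. -/
def liftTotal {σ : D → D} (f : ∀ x, E x →ₗ⋆[ℂ] E (σ x)) (p : TotalSpace F E) :
    TotalSpace F E :=
  TotalSpace.mk' F (σ p.proj) (f p.proj p.snd)

/-- The conjugate-linear fiber maps `f x : E x → E (σ x)`, for `x` in `D' = H · S`, form an
anti-holomorphic endomorphism, lifting `σ`, of the `H`-equivariant Hermitian bundle `E` over `D'`:
they are isometric, the map of total spaces is anti-holomorphic, and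
`L_{τ h} ∘ f = f ∘ L_h`, where `τ` is the automorphism of `H` compatible with `σ`. -/
structure IsAntiholomorphicLift (𝓛 : BundleAction ED F E H) (S : Set D) (σ : D → D) (τ : H ≃* H)
    (f : ∀ x, E x →ₗ⋆[ℂ] E (σ x)) : Prop where
  isometric : ∀ x ∈ orbitSet H S, ∀ v : E x, ‖f x v‖ = ‖v‖
  antiholomorphic : AntiholomorphicOn (𝓘(ℝ, ED).prod 𝓘(ℝ, F)) (𝓘(ℝ, ED).prod 𝓘(ℝ, F))
    (liftTotal f : TotalSpace F E → TotalSpace F E) (π F E ⁻¹' orbitSet H S)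
  equivariant : ∀ (h : H) (p : TotalSpace F E), p.proj ∈ orbitSet H S →
    𝓛.total (τ h) (liftTotal f p) = liftTotal f (𝓛.total h p)

end BundleAction

end Bundles

/-! The proof is a reproducing-kernel argument. Point evaluations of a realized representation are
continuous, so every point `p` of the bundle has a vector `K_p` (`kernelVector`) that represents
pairing with `p`. An intertwining operator `A` is encoded by its kernel `⟪A K_q, K_p⟫`.

The central claim is that the lift `f` of `σ` conjugates this kernel: `⟪A K_{f p}, K_{f q}⟫ = ⟪A
K_q, K_p⟫`. Over a point of `S`, compressing `A` to the fiber gives an operator commuting with the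
isotropy group. By Schur's lemma and multiplicity-freeness it is a scalar on each irreducible
summand, so a conjugate-linear isometry preserving the summands carries it to its adjoint
(`inner_kernelVector_lift_of_mem`). Equivariance spreads the identity to pairs over one common point
of `H · S`. Both sides are holomorphic in one point and antiholomorphic in the other, so equality on
the diagonal forces equality near it (`inner_kernelVector_lift_of_mem_ball`).

By the identity theorem the kernel vectors over any nonempty open set are total. The case `A = 1`
therefore yields an antiunitary `J` with `J K_p = K_{f p}`, and the general case yields `J A = A† J`
(`exists_antiunitary`). Hence `J A B = A† B† J = (B A)† J = J B A`, and injectivity of `J` gives `A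
B = B A`. -/

open Filter Topology ComplexConjugate InnerProductSpace

/-! ### Weak holomorphy and the diagonal uniqueness principle -/

section WeakHolomorphy

variable {V : Type*} [NormedAddCommGroup V] [InnerProductSpace ℂ V]

/-- If `h` is holomorphic and bounded by `C` on a disc, its difference quotients at the center are
Lipschitz at the center. -/
theorem norm_dslope_sub_dslope_le {h : ℂ → ℂ} {c : ℂ} {R C : ℝ}
    (hd : DifferentiableOn ℂ h (Metric.ball c R)) (hb : ∀ z ∈ Metric.ball c R, ‖h z‖ ≤ C)
    {z : ℂ} (hz : z ∈ Metric.ball c R) :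
    ‖dslope h c z - dslope h c c‖ ≤ 4 * C / R / R * ‖z - c‖ := by
  have hR : 0 < R := Metric.pos_of_mem_ball hz
  have hc : c ∈ Metric.ball c R := Metric.mem_ball_self hR
  -- Schwarz's lemma, used twice: `h` stays within `2C` of `h c`, so `dslope h c` is bounded by
  -- `2C/R` and stays within `4C/R` of its central value.
  have h1 : ∀ w ∈ Metric.ball c R, ‖dslope h c w‖ ≤ 2 * C / R := by
    intro w hw
    refine Complex.norm_dslope_le_div_of_mapsTo_ball hd ?_ hw
    intro u hu
    rw [Metric.mem_closedBall, dist_eq_norm]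
    linarith [norm_sub_le (h u) (h c), hb u hu, hb c hc]
  have hd' : DifferentiableOn ℂ (dslope h c) (Metric.ball c R) :=
    (Complex.differentiableOn_dslope (Metric.ball_mem_nhds c hR)).2 hd
  have h2 : ‖dslope (dslope h c) c z‖ ≤ 4 * C / R / R := by
    refine Complex.norm_dslope_le_div_of_mapsTo_ball hd' ?_ hz
    intro u hu
    rw [Metric.mem_closedBall, dist_eq_norm]
    have : 4 * C / R = 2 * C / R + 2 * C / R := by ring
    linarith [norm_sub_le (dslope h c u) (dslope h c c), h1 u hu, h1 c hc]
  rw [← sub_smul_dslope (dslope h c) c z, norm_smul, mul_comm]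
  gcongr

/-- A weakly holomorphic map from an open subset of `ℂ` to a Hilbert space is holomorphic. -/
theorem differentiableOn_of_inner [CompleteSpace V] {a : ℂ → V} {U : Set ℂ} (hU : IsOpen U)
    (h : ∀ φ : V, DifferentiableOn ℂ (fun z => ⟪φ, a z⟫_ℂ) U) : DifferentiableOn ℂ a U := by
  intro c hc
  obtain ⟨R, hR, hRU⟩ := Metric.nhds_basis_closedBall.mem_iff.1 (hU.mem_nhds hc)
  -- Uniform boundedness upgrades weak boundedness on the compact disc to a norm bound.
  obtain ⟨C, hC⟩ : ∃ C, ∀ z : Metric.closedBall c R, ‖innerSL ℂ (a z)‖ ≤ C := by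
    refine banach_steinhaus fun φ => ?_
    obtain ⟨C, hC⟩ := (isCompact_closedBall c R).exists_bound_of_continuousOn
      ((h φ).continuousOn.mono hRU)
    refine ⟨C, fun z => ?_⟩
    rw [innerSL_apply_apply, norm_inner_symm]
    exact hC z z.2
  have hCb : ∀ z ∈ Metric.ball c R, ‖a z‖ ≤ C := fun z hz => by
    simpa using hC ⟨z, Metric.ball_subset_closedBall hz⟩
  have key : ∀ z ∈ Metric.ball c R, ∀ w ∈ Metric.ball c R, z ≠ c → w ≠ c →
      ‖slope a c z - slope a c w‖ ≤ 4 * C / R / R * (‖z - c‖ + ‖w - c‖) := by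
    intro z hz w hw hzc hwc
    -- Testing the difference of two slopes against itself turns the scalar estimate into a norm
    -- estimate.
    set v := slope a c z - slope a c w with hv
    have hb : ∀ u ∈ Metric.ball c R, ‖⟪v, a u⟫_ℂ‖ ≤ ‖v‖ * C := fun u hu =>
      (norm_inner_le_norm _ _).trans (by gcongr; exact hCb u hu)
    have hd := (h v).mono (Metric.ball_subset_closedBall.trans hRU)
    have hs : ∀ u, u ≠ c → ⟪v, slope a c u⟫_ℂ = dslope (fun z => ⟪v, a z⟫_ℂ) c u := by
      intro u hu
      rw [dslope_of_ne _ hu, slope_def_module, slope_def_module, inner_smul_right, inner_sub_right,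
        smul_eq_mul]
    have h1 := norm_dslope_sub_dslope_le hd hb hz
    have h2 := norm_dslope_sub_dslope_le hd hb hw
    have h3 : ‖v‖ * ‖v‖ ≤ ‖v‖ * (4 * C / R / R * (‖z - c‖ + ‖w - c‖)) := by
      have h4 : ⟪v, v⟫_ℂ = (dslope (fun z => ⟪v, a z⟫_ℂ) c z - dslope (fun z => ⟪v, a z⟫_ℂ) c c) -
          (dslope (fun z => ⟪v, a z⟫_ℂ) c w - dslope (fun z => ⟪v, a z⟫_ℂ) c c) := by
        rw [← hs z hzc, ← hs w hwc, sub_sub_sub_cancel_right, ← inner_sub_right]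
      have h5 : (‖v‖ * ‖v‖ : ℝ) = ‖⟪v, v⟫_ℂ‖ := by
        rw [inner_self_eq_norm_sq_to_K]
        simp [sq]
      rw [h5, h4]
      refine (norm_sub_le _ _).trans ((add_le_add h1 h2).trans_eq ?_)
      ring
    rcases (norm_nonneg v).eq_or_lt with h0 | h0
    · rw [← h0]
      have : 0 ≤ C := (norm_nonneg _).trans (hCb z hz)
      positivity
    · exact le_of_mul_le_mul_left h3 h0
  have hcau : Cauchy (map (slope a c) (𝓝[≠] c)) := by
    rw [Metric.cauchy_iff]
    refine ⟨inferInstance, fun ε hε => ?_⟩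
    set K := 4 * C / R / R
    set δ := min R (ε / (2 * (|K| + 1)))
    have hδ : 0 < δ := by positivity
    refine ⟨slope a c '' (Metric.ball c δ ∩ {c}ᶜ), image_mem_map
      (inter_mem (mem_nhdsWithin_of_mem_nhds (Metric.ball_mem_nhds c hδ)) self_mem_nhdsWithin), ?_⟩
    rintro _ ⟨z, ⟨hz, hzc⟩, rfl⟩ _ ⟨w, ⟨hw, hwc⟩, rfl⟩
    have hδR : Metric.ball c δ ⊆ Metric.ball c R := Metric.ball_subset_ball (min_le_left _ _)
    rw [dist_eq_norm]
    refine (key z (hδR hz) w (hδR hw) hzc hwc).trans_lt ?_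
    rw [mem_ball_iff_norm] at hz hw
    calc K * (‖z - c‖ + ‖w - c‖) ≤ (|K| + 1) * (‖z - c‖ + ‖w - c‖) := by
          gcongr; linarith [le_abs_self K]
      _ < (|K| + 1) * (ε / (2 * (|K| + 1)) + ε / (2 * (|K| + 1))) := by
          gcongr
          · exact hz.trans_le (min_le_right _ _)
          · exact hw.trans_le (min_le_right _ _)
      _ = ε := by field_simp; ring
  obtain ⟨a', ha'⟩ := CompleteSpace.complete hcau
  exact (hasDerivAt_iff_tendsto_slope.2 ha').differentiableAt.differentiableWithinAt

/-- The pairing of an antiholomorphic and a holomorphic map into a Hilbert space, both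
reparametrized to be holomorphic, is holomorphic. -/
theorem differentiableAt_inner_comp_conj {β γ : ℂ → V} {q : ℂ}
    (hβ : ContinuousAt β q) (hβ' : ∀ φ, DifferentiableAt ℂ (fun z => ⟪β z, φ⟫_ℂ) q)
    (hγ : DifferentiableAt ℂ γ q) : DifferentiableAt ℂ (fun z => ⟪β z, γ z⟫_ℂ) q := by
  -- The slope of the pairing is `⟪β z, slope γ q z⟫` plus the slope of `⟪β ·, γ q⟫`, so norm
  -- continuity and weak differentiability of `β` suffice.
  have h1 := hasDerivAt_iff_tendsto_slope.1 hγ.hasDerivAt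
  have h2 := hasDerivAt_iff_tendsto_slope.1 (hβ' (γ q)).hasDerivAt
  have h3 : Tendsto (fun z => ⟪β z, slope γ q z⟫_ℂ) (𝓝[≠] q) (𝓝 ⟪β q, deriv γ q⟫_ℂ) :=
    Tendsto.inner (hβ.mono_left nhdsWithin_le_nhds) h1
  refine HasDerivAt.differentiableAt (hasDerivAt_iff_tendsto_slope.2 ((h3.add h2).congr ?_))
  intro z
  simp only [slope_def_module, inner_smul_right, inner_sub_right, smul_eq_mul]
  ring

/-- A kernel which is holomorphic in the first and antiholomorphic in the second variable and
vanishes on the diagonal vanishes. -/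
theorem eq_zero_of_eq_zero_on_diagonal {X : Type*} [NormedAddCommGroup X] [NormedSpace ℂ X]
    {k : X → X → ℂ} {z₀ : X} {r : ℝ}
    (hk : ∀ m d : X, DifferentiableOn ℂ (fun q : ℂ => k (m + q • d) (m + conj q • d))
      {q | m + q • d ∈ Metric.ball z₀ (3 * r) ∧ m + conj q • d ∈ Metric.ball z₀ (3 * r)})
    (hdiag : ∀ z ∈ Metric.ball z₀ (3 * r), k z z = 0) {z w : X}
    (hz : z ∈ Metric.ball z₀ r) (hw : w ∈ Metric.ball z₀ r) : k z w = 0 := by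
  -- On the line `q ↦ (m + q d, m + conj q d)` the kernel depends holomorphically on the single
  -- variable `q`. Real `q` lie on the diagonal, and `q = i` gives `(z, w)`. The bounds `‖m - z₀‖,
  -- ‖d‖ < r` and `‖q‖ < 2` explain the radius `3r`.
  set m : X := (1 / 2 : ℂ) • (z + w) with hm
  set d : X := (-Complex.I / 2) • (z - w) with hd
  rw [mem_ball_iff_norm] at hz hw
  have hmz : ‖m - z₀‖ < r := by
    have : m - z₀ = (1 / 2 : ℂ) • ((z - z₀) + (w - z₀)) := by
      rw [hm]; module
    rw [this, norm_smul]
    have := norm_add_le (z - z₀) (w - z₀)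
    norm_num
    linarith
  have hdr : ‖d‖ < r := by
    rw [hd, norm_smul]
    have := norm_sub_le (z - z₀) (w - z₀)
    rw [sub_sub_sub_cancel_right] at this
    norm_num
    linarith
  have hmem : ∀ q : ℂ, ‖q‖ < 2 → m + q • d ∈ Metric.ball z₀ (3 * r) := by
    intro q hq
    rw [mem_ball_iff_norm, add_sub_right_comm]
    refine (norm_add_le _ _).trans_lt ?_
    rw [norm_smul]
    nlinarith [norm_nonneg q, norm_nonneg d]
  have hg : AnalyticOnNhd ℂ (fun q : ℂ => k (m + q • d) (m + conj q • d)) (Metric.ball 0 2) := by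
    refine DifferentiableOn.analyticOnNhd ((hk m d).mono fun q hq => ?_) Metric.isOpen_ball
    rw [mem_ball_zero_iff] at hq
    exact ⟨hmem q hq, hmem _ (by simpa using hq)⟩
  have hzero := hg.eqOn_zero_of_preconnected_of_frequently_eq_zero
    (convex_ball _ _).isPreconnected (z₀ := 0) (by simp) ?_
  · have := hzero (x := Complex.I) (by simp)
    simp only [Complex.conj_I] at this
    have e1 : m + Complex.I • d = z := by
      rw [hm, hd, smul_smul, show Complex.I * (-Complex.I / 2) = 1 / 2 by
        rw [mul_div_assoc', mul_neg, Complex.I_mul_I]; ring]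
      module
    have e2 : m + (-Complex.I) • d = w := by
      rw [hm, hd, smul_smul, show -Complex.I * (-Complex.I / 2) = -(1 / 2) by
        rw [mul_div_assoc', neg_mul_neg, Complex.I_mul_I]; ring]
      module
    rwa [e1, e2] at this
  · have ht : Tendsto (fun n : ℕ => ((1 / ((n : ℝ) + 1) : ℝ) : ℂ)) atTop (𝓝[≠] 0) := by
      refine tendsto_nhdsWithin_iff.2 ⟨?_, Eventually.of_forall fun n => ?_⟩
      · exact (Complex.continuous_ofReal.tendsto' 0 0 (by simp)).comp
          tendsto_one_div_add_atTop_nhds_zero_nat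
      · have : (0 : ℝ) < 1 / ((n : ℝ) + 1) := by positivity
        simpa using (Complex.ofReal_ne_zero.2 this.ne')
    refine ht.frequently (Frequently.of_forall fun n => ?_)
    simp only [Complex.conj_ofReal]
    refine hdiag _ (hmem _ ?_)
    rw [Complex.norm_real, Real.norm_of_nonneg (by positivity), div_lt_iff₀ (by positivity)]
    have : (0 : ℝ) ≤ n := n.cast_nonneg
    linarith

end WeakHolomorphy

/-! ### Commutativity from an antiunitary symmetry -/

section Antiunitary

variable {V : Type*} [NormedAddCommGroup V] [InnerProductSpace ℂ V] [CompleteSpace V]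

open Submodule ContinuousLinearMap in
/-- If `a` and `b` are total families with `⟪b i, b j⟫ = conj ⟪a i, a j⟫`, there is an antiunitary
`J` with `J (a i) = b i`, and every `A` with `⟪b i, A† b j⟫ = conj ⟪a i, A a j⟫`
satisfies `J A = A† J`. -/
theorem exists_antiunitary {ι : Type*} {a b : ι → V}
    (ha : Dense (span ℂ (Set.range a) : Set V)) (hb : Dense (span ℂ (Set.range b) : Set V))
    (hab : ∀ i j, ⟪b i, b j⟫_ℂ = ⟪a j, a i⟫_ℂ) :
    ∃ J : V →L⋆[ℂ] V, Function.Injective J ∧ ∀ A : V →L[ℂ] V,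
      (∀ i j, ⟪b i, adjoint A (b j)⟫_ℂ = ⟪A (a j), a i⟫_ℂ) → ∀ v, J (A v) = adjoint A (J v) := by
  classical
  -- `J` is defined on formal combinations because the `a i` may be linearly dependent; the equality
  -- of norms `hnorm` lets it descend to their span and extend to `V`.
  let e : (ι →₀ ℂ) →ₗ[ℂ] V := Finsupp.linearCombination ℂ a
  let g : (ι →₀ ℂ) →ₛₗ[starRingEnd ℂ] V :=
    { toFun c := c.sum fun i z => conj z • b i
      map_add' c c' := by
        refine Finsupp.sum_add_index' (by simp) (by simp [add_smul])
      map_smul' t c := by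
        rw [Finsupp.sum_smul_index' (by simp), Finsupp.smul_sum]
        simp [mul_smul] }
  have he : ∀ i z, e (Finsupp.single i z) = z • a i := fun i z => by simp [e]
  have hg : ∀ i z, g (Finsupp.single i z) = conj z • b i := fun i z => by
    simp [g]
  have hinner : ∀ A B : V →L[ℂ] V, (∀ i j, ⟪b i, A (b j)⟫_ℂ = ⟪B (a j), a i⟫_ℂ) →
      ∀ c c', ⟪g c, A (g c')⟫_ℂ = ⟪B (e c'), e c⟫_ℂ := by
    intro A B h c c'
    induction c using Finsupp.induction_linear with
    | zero => simp
    | add c₁ c₂ h₁ h₂ => simp [h₁, h₂]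
    | single i z =>
      induction c' using Finsupp.induction_linear with
      | zero => simp
      | add c₁ c₂ h₁ h₂ => simp [h₁, h₂]
      | single j w =>
        simp only [he, hg, map_smul, inner_smul_left, inner_smul_right, h, Complex.conj_conj]
        ring
  have hdense_e : DenseRange e := by
    rw [DenseRange, ← LinearMap.coe_range, Finsupp.range_linearCombination]
    exact ha
  have hdense_g : Dense (Set.range g) := by
    refine hb.mono ?_
    have : RingHomSurjective (starRingEnd ℂ) := inferInstance
    rw [← LinearMap.coe_range]
    refine SetLike.coe_subset_coe.2 (span_le.2 ?_)
    rintro _ ⟨i, rfl⟩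
    exact ⟨Finsupp.single i 1, by simp [hg]⟩
  have hnorm : ∀ c, ‖g c‖ = ‖e c‖ := by
    intro c
    have h := hinner 1 1 hab c c
    simp only [one_apply_eq_self] at h
    rw [inner_self_eq_norm_sq_to_K, inner_self_eq_norm_sq_to_K] at h
    exact (sq_eq_sq₀ (norm_nonneg _) (norm_nonneg _)).1 (by exact_mod_cast h)
  have hle : ∀ c, ‖g c‖ ≤ 1 * ‖e c‖ := fun c => by rw [hnorm, one_mul]
  let J : V →L⋆[ℂ] V := g.extendOfNorm e
  have hJe : ∀ c, J (e c) = g c := fun c => LinearMap.extendOfNorm_eq hdense_e ⟨1, hle⟩ c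
  have hJnorm : ∀ v, ‖J v‖ = ‖v‖ := by
    intro v
    refine hdense_e.induction_on v (isClosed_eq (by fun_prop) (by fun_prop)) fun c => ?_
    rw [hJe, hnorm]
  have hJinner : ∀ v w, ⟪J v, J w⟫_ℂ = ⟪w, v⟫_ℂ := by
    intro v w
    refine hdense_e.induction_on v (isClosed_eq (by fun_prop) (by fun_prop)) fun c => ?_
    refine hdense_e.induction_on w (isClosed_eq (by fun_prop) (by fun_prop)) fun c' => ?_
    simpa [hJe] using hinner 1 1 hab c c'
  refine ⟨J, ?_, fun A hA v => ?_⟩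
  · rw [injective_iff_map_eq_zero]
    intro v hv
    rw [← norm_eq_zero, ← hJnorm, hv, norm_zero]
  · refine hdense_e.induction_on v (isClosed_eq (by fun_prop) (by fun_prop)) fun c => ?_
    refine hdense_g.eq_of_inner_right (𝕜 := ℂ) ?_
    rintro _ ⟨c', rfl⟩
    rw [hJe, hinner _ _ hA, ← hJe, hJinner]

open Submodule ContinuousLinearMap in
/-- A set of operators containing `1`, closed under products and symmetric with respect to two
total families as in `exists_antiunitary` is commutative. -/
theorem mul_comm_of_total_families {ι : Type*} {a b : ι → V}
    (ha : Dense (span ℂ (Set.range a) : Set V)) (hb : Dense (span ℂ (Set.range b) : Set V))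
    {R : Set (V →L[ℂ] V)} (hone : 1 ∈ R) (hmul : ∀ A ∈ R, ∀ B ∈ R, A * B ∈ R)
    (hR : ∀ A ∈ R, ∀ i j, ⟪b i, adjoint A (b j)⟫_ℂ = ⟪A (a j), a i⟫_ℂ)
    {A B : V →L[ℂ] V} (hA : A ∈ R) (hB : B ∈ R) : A * B = B * A := by
  obtain ⟨J, hJ, hJA⟩ := exists_antiunitary ha hb fun i j => by
    simpa only [one_apply_eq_self, ← star_eq_adjoint, star_one] using hR 1 hone i j
  ext v
  refine hJ ?_
  rw [mul_apply_eq_comp, hJA A (hR A hA), hJA B (hR B hB), hJA (B * A) (hR _ (hmul B hB A hA)),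
    ← star_eq_adjoint, ← star_eq_adjoint, ← star_eq_adjoint, star_mul, mul_apply_eq_comp]

end Antiunitary

/-! ### Holomorphy in terms of real derivatives -/

section RealHolomorphic

variable {E HM M E' HM' M' E'' HM'' M'' : Type*}
    [NormedAddCommGroup E] [NormedSpace ℂ E]
    [TopologicalSpace HM] [TopologicalSpace M] [ChartedSpace HM M]
    [NormedAddCommGroup E'] [NormedSpace ℂ E']
    [TopologicalSpace HM'] [TopologicalSpace M'] [ChartedSpace HM' M']
    [NormedAddCommGroup E''] [NormedSpace ℂ E'']
    [TopologicalSpace HM''] [TopologicalSpace M''] [ChartedSpace HM'' M'']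

/-- `f` is real differentiable at `x` with complex linear derivative. -/
def HolomorphicAt (I : ModelWithCorners ℝ E HM) (I' : ModelWithCorners ℝ E' HM') (f : M → M')
    (x : M) : Prop :=
  ∃ A : E →L[ℝ] E', HasMFDerivAt I I' f x A ∧ ∀ v : E, A (Complex.I • v) = Complex.I • A v

variable {I : ModelWithCorners ℝ E HM} {I' : ModelWithCorners ℝ E' HM'}
  {I'' : ModelWithCorners ℝ E'' HM''}

theorem HolomorphicAt.comp {g : M' → M''} {f : M → M'} (x : M) (hg : HolomorphicAt I' I'' g (f x))
    (hf : HolomorphicAt I I' f x) : HolomorphicAt I I'' (g ∘ f) x := by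
  obtain ⟨A, hA, hA'⟩ := hf
  obtain ⟨B, hB, hB'⟩ := hg
  exact ⟨B.comp A, hB.comp x hA, fun v => by simp [hA', hB']⟩

theorem MDifferentiableAt.holomorphicAt {J : ModelWithCorners ℂ E HM}
    {J' : ModelWithCorners ℂ E' HM'} (hJ : ⇑J = ⇑I) (hJs : ⇑J.symm = ⇑I.symm)
    (hJ' : ⇑J' = ⇑I') {f : M → M'} {x : M}
    (hf : MDifferentiableAt J J' f x) : HolomorphicAt I I' f x := by
  have h := hf.hasMFDerivAt
  refine ⟨(mfderiv J J' f x : E →L[ℂ] E').restrictScalars ℝ, ⟨h.1, ?_⟩, fun v =>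
    map_smul (mfderiv J J' f x : E →L[ℂ] E') Complex.I v⟩
  have h2 := HasFDerivWithinAt.restrictScalars ℝ h.2
  have e1 : writtenInExtChartAt J J' x f = writtenInExtChartAt I I' x f := by
    ext z
    simp only [writtenInExtChartAt, extChartAt_coe, extChartAt_coe_symm, Function.comp_apply, hJs,
      hJ']
  have e2 : extChartAt J x x = extChartAt I x x := by
    simp only [extChartAt_coe, Function.comp_apply, hJ]
  rw [e1, e2, hJ] at h2
  exact h2

theorem HolomorphicAt.differentiableAt {f : E → E'} {x : E}
    (hf : HolomorphicAt 𝓘(ℝ, E) 𝓘(ℝ, E') f x) : DifferentiableAt ℂ f x := by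
  obtain ⟨A, hA, hA'⟩ := hf
  have hlin : ∀ (c : ℂ) (v : E), A (c • v) = c • A v := by
    intro c v
    conv_lhs => rw [← Complex.re_add_im c]
    conv_rhs => rw [← Complex.re_add_im c]
    simp only [add_smul, mul_smul, map_add, Complex.coe_smul, map_smul, hA']
  let B : E →L[ℂ] E' := ⟨{ toFun := A, map_add' := map_add A, map_smul' := hlin }, A.continuous⟩
  exact (hasFDerivAt_of_restrictScalars ℝ hA.hasFDerivAt (f' := B) (by ext; rfl)).differentiableAt

end RealHolomorphic

/-! ### Coordinates on the bundle -/

section Coordinates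

variable {ED : Type*} [NormedAddCommGroup ED]
  {D : Type*} [TopologicalSpace D] [ChartedSpace ED D]
  {F : Type*} [NormedAddCommGroup F] [NormedSpace ℂ F]
  {E : D → Type*} [∀ x, NormedAddCommGroup (E x)] [∀ x, InnerProductSpace ℂ (E x)]
  [TopologicalSpace (TotalSpace F E)] [FiberBundle F E]

/-- The expression of a map `D → TotalSpace F E` in the chart at `y₀` and the trivialization at
`y₀`. -/
noncomputable def inCoordinates (y₀ : D) (g : D → TotalSpace F E) (z : ED) : F :=
  (trivializationAt F E y₀ (g ((chartAt ED y₀).symm z))).2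

/-- The part of the chart at `y₀` lying over the domain of the trivialization at `y₀`. -/
def coordinateDomain (F : Type*) [NormedAddCommGroup F] [NormedSpace ℂ F]
    (E : D → Type*) [∀ x, NormedAddCommGroup (E x)] [∀ x, InnerProductSpace ℂ (E x)]
    [TopologicalSpace (TotalSpace F E)] [FiberBundle F E] (y₀ : D) : Set ED :=
  (chartAt ED y₀).target ∩ (chartAt ED y₀).symm ⁻¹' (trivializationAt F E y₀).baseSet

theorem isOpen_coordinateDomain (y₀ : D) : IsOpen (coordinateDomain (ED := ED) F E y₀) :=
  (chartAt ED y₀).isOpen_inter_preimage_symm (trivializationAt F E y₀).open_baseSet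

theorem mem_coordinateDomain (y₀ : D) : chartAt ED y₀ y₀ ∈ coordinateDomain (ED := ED) F E y₀ := by
  refine ⟨mem_chart_target ED y₀, ?_⟩
  rw [Set.mem_preimage, (chartAt ED y₀).left_inv (mem_chart_source ED y₀)]
  exact FiberBundle.mem_baseSet_trivializationAt' y₀

end Coordinates

/-! ### Holomorphic sections and the identity theorem -/

section Bundles

variable {ED : Type*} [NormedAddCommGroup ED] [NormedSpace ℂ ED]
  {D : Type*} [TopologicalSpace D] [ChartedSpace ED D] [IsManifold 𝓘(ℂ, ED) ω D]
  {F : Type*} [NormedAddCommGroup F] [NormedSpace ℂ F]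
  {E : D → Type*} [∀ x, NormedAddCommGroup (E x)] [∀ x, InnerProductSpace ℂ (E x)]
  [TopologicalSpace (TotalSpace F E)] [FiberBundle F E] [VectorBundle ℂ F E]
  [ContMDiffVectorBundle ω F E 𝓘(ℂ, ED)]

theorem analyticOnNhd_inCoordinates (s : HolSection ED F E) (y₀ : D) :
    AnalyticOnNhd ℂ (inCoordinates y₀ fun x => TotalSpace.mk' F x (s x))
      (coordinateDomain (ED := ED) F E y₀) := by
  have h1 : ContMDiffOn 𝓘(ℂ, ED) 𝓘(ℂ, F) ω
      (fun x => (trivializationAt F E y₀ (TotalSpace.mk' F x (s x))).2)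
      (trivializationAt F E y₀).baseSet :=
    ((trivializationAt F E y₀).contMDiffOn_section_baseSet_iff).1 s.contMDiff.contMDiffOn
  have hc : ContMDiffOn 𝓘(ℂ, ED) 𝓘(ℂ, ED) ω (chartAt ED y₀).symm
      (coordinateDomain (ED := ED) F E y₀) :=
    contMDiffOn_chart_symm.mono Set.inter_subset_left
  have h2 := h1.comp hc fun z hz => hz.2
  have h3 := (contMDiffOn_iff_contDiffOn.1 h2).analyticOn
  exact (isOpen_coordinateDomain y₀).analyticOn_iff_analyticOnNhd.1 h3

/-- A holomorphic section over a connected manifold vanishing on a nonempty open set vanishes. -/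
theorem HolSection.eq_zero_of_eqOn_open [ConnectedSpace D] (s : HolSection ED F E) {U : Set D}
    (hU : IsOpen U) (hne : U.Nonempty) (h : ∀ x ∈ U, s x = 0) : s = 0 := by
  -- `Z` is open by construction; it is closed because a coordinate ball around a point of its
  -- closure meets `Z`, and the identity theorem annihilates `s` on that ball.
  set Z : Set D := interior {x | s x = 0} with hZ
  have hZs : ∀ {x}, x ∈ Z → s x = 0 := fun {x} hx =>
    (interior_subset hx : x ∈ {x | s x = 0})
  have hclosed : IsClosed Z := by
    refine isClosed_of_closure_subset fun y hy => ?_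
    set c := chartAt ED y
    set e := trivializationAt F E y
    have hbase : ∀ x (hx : x ∈ e.baseSet), (e (TotalSpace.mk' F x (s x))).2 = 0 ↔ s x = 0 := by
      intro x hx
      exact (e.continuousLinearEquivAt ℂ x hx).map_eq_zero_iff
    obtain ⟨R, hR, hball⟩ := Metric.isOpen_iff.1 (isOpen_coordinateDomain (ED := ED) (F := F)
      (E := E) y) _ (mem_coordinateDomain y)
    set W : Set D := c.source ∩ c ⁻¹' Metric.ball (c y) R
    have hW : IsOpen W := c.isOpen_inter_preimage Metric.isOpen_ball
    have hyW : y ∈ W := ⟨mem_chart_source ED y, Metric.mem_ball_self hR⟩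
    obtain ⟨x, hxW, hxZ⟩ := mem_closure_iff.1 hy W hW hyW
    have hev : inCoordinates y (fun x => TotalSpace.mk' F x (s x)) =ᶠ[𝓝 (c x)] 0 := by
      have hx' : c.symm (c x) = x := c.left_inv hxW.1
      have ht : ∀ᶠ z in 𝓝 (c x), c.symm z ∈ Z :=
        (c.continuousAt_symm (c.map_source hxW.1)).eventually_mem
          (by rw [hx']; exact isOpen_interior.mem_nhds hxZ)
      filter_upwards [ht, Metric.isOpen_ball.mem_nhds hxW.2] with z hz hzb
      exact (hbase _ (hball hzb).2).2 (hZs hz)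
    have hzero := ((analyticOnNhd_inCoordinates s y).mono hball
      ).eqOn_zero_of_preconnected_of_eventuallyEq_zero
      (convex_ball _ _).isPreconnected hxW.2 hev
    refine mem_interior.2 ⟨W, fun w hw => ?_, hW, hyW⟩
    have h1 := hzero hw.2
    have h2 := (hball hw.2).2
    rw [Set.mem_preimage, c.left_inv hw.1] at h2
    simp only [inCoordinates] at h1
    rw [c.left_inv hw.1] at h1
    exact (hbase w h2).1 h1
  have huniv : Z = Set.univ := IsClopen.eq_univ ⟨hclosed, isOpen_interior⟩
    (hne.mono (interior_maximal h hU))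
  ext x
  have hx : x ∈ Z := huniv ▸ Set.mem_univ x
  exact hZs hx

/-- The expression in coordinates of the image of a holomorphic section under an antiholomorphic
bundle map covering an antiholomorphic map is holomorphic. -/
theorem differentiableAt_inCoordinates_antiholomorphic (s : HolSection ED F E) (y₀ : D)
    {Φ : TotalSpace F E → TotalSpace F E} {θ : D → D} {U : Set D} {U' : Set (TotalSpace F E)}
    (hΦ : AntiholomorphicOn (𝓘(ℝ, ED).prod 𝓘(ℝ, F)) (𝓘(ℝ, ED).prod 𝓘(ℝ, F)) Φ U')
    (hθ : AntiholomorphicOn 𝓘(ℝ, ED) 𝓘(ℝ, ED) θ U) {z : ED}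
    (hz : z ∈ (chartAt ED y₀).target) (hzU : (chartAt ED y₀).symm z ∈ U)
    (hzU' : TotalSpace.mk' F (θ ((chartAt ED y₀).symm z)) (s (θ ((chartAt ED y₀).symm z))) ∈ U')
    (hzb : (Φ (TotalSpace.mk' F (θ ((chartAt ED y₀).symm z))
      (s (θ ((chartAt ED y₀).symm z))))).proj ∈ (trivializationAt F E y₀).baseSet) :
    DifferentiableAt ℂ
      (inCoordinates y₀ fun y => Φ (TotalSpace.mk' F (θ y) (s (θ y)))) z := by
  have h1 : HolomorphicAt 𝓘(ℝ, ED) 𝓘(ℝ, ED) (chartAt ED y₀).symm z := by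
    refine MDifferentiableAt.holomorphicAt (J := 𝓘(ℂ, ED)) (J' := 𝓘(ℂ, ED)) rfl rfl rfl ?_
    exact ((contMDiffOn_chart_symm (I := 𝓘(ℂ, ED)) (n := ω) (x := y₀)).contMDiffAt
      ((chartAt ED y₀).open_target.mem_nhds hz)).mdifferentiableAt (by simp)
  have h2 : HolomorphicAt 𝓘(ℝ, ED) (𝓘(ℝ, ED).prod 𝓘(ℝ, F)) (fun x => TotalSpace.mk' F x (s x))
      (θ ((chartAt ED y₀).symm z)) := by
    refine MDifferentiableAt.holomorphicAt (J := 𝓘(ℂ, ED)) (J' := 𝓘(ℂ, ED).prod 𝓘(ℂ, F))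
      rfl rfl rfl ?_
    exact (s.contMDiff _).mdifferentiableAt (by simp)
  have h3 : HolomorphicAt (𝓘(ℝ, ED).prod 𝓘(ℝ, F)) 𝓘(ℝ, F)
      (fun p : TotalSpace F E => (trivializationAt F E y₀ p).2)
      (Φ (TotalSpace.mk' F (θ ((chartAt ED y₀).symm z)) (s (θ ((chartAt ED y₀).symm z))))) := by
    refine MDifferentiableAt.holomorphicAt (J := 𝓘(ℂ, ED).prod 𝓘(ℂ, F)) (J' := 𝓘(ℂ, F))
      rfl rfl rfl ?_
    have h := ((trivializationAt F E y₀).contMDiffOn (IB := 𝓘(ℂ, ED)) (n := ω)).contMDiffAt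
      ((trivializationAt F E y₀).open_source.mem_nhds ((trivializationAt F E y₀).mem_source.2 hzb))
    exact h.snd.mdifferentiableAt (by simp)
  obtain ⟨A₁, hA₁, hA₁'⟩ := hθ _ hzU
  obtain ⟨A₂, hA₂, hA₂'⟩ := h2
  obtain ⟨A₃, hA₃, hA₃'⟩ := hΦ _ hzU'
  -- The conjugate-linear derivatives of `θ` and `Φ` cancel each other's conjugation.
  have h4 : HolomorphicAt 𝓘(ℝ, ED) (𝓘(ℝ, ED).prod 𝓘(ℝ, F))
      (fun y => Φ (TotalSpace.mk' F (θ y) (s (θ y)))) ((chartAt ED y₀).symm z) :=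
    ⟨(A₃.comp A₂).comp A₁, HasMFDerivAt.comp (g := fun x => Φ (TotalSpace.mk' F x (s x)))
      (f := θ) _ (HasMFDerivAt.comp (g := Φ) _ hA₃ hA₂) hA₁, fun v => by
        simp [hA₁', hA₂', hA₃']⟩
  have h5 := HolomorphicAt.comp (g := fun p : TotalSpace F E => (trivializationAt F E y₀ p).2)
    (f := fun y => Φ (TotalSpace.mk' F (θ y) (s (θ y)))) _ h3 h4
  exact (HolomorphicAt.comp (f := (chartAt ED y₀).symm) z h5 h1).differentiableAt

end Bundles

/-! ### Holomorphy of pairings of vector-valued maps -/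

section Pairing

variable {V : Type*} [NormedAddCommGroup V] [InnerProductSpace ℂ V] [CompleteSpace V]

/-- The pairing of a weakly antiholomorphic and a weakly holomorphic map is holomorphic. -/
theorem differentiableOn_inner_of_weak {β γ : ℂ → V} {U : Set ℂ} (hU : IsOpen U)
    (hβ : ∀ φ, DifferentiableOn ℂ (fun q => ⟪β q, φ⟫_ℂ) U)
    (hγ : ∀ φ, DifferentiableOn ℂ (fun q => ⟪φ, γ q⟫_ℂ) U) :
    DifferentiableOn ℂ (fun q => ⟪β q, γ q⟫_ℂ) U := by
  intro q hq
  have hγ' := (differentiableOn_of_inner hU hγ).differentiableAt (hU.mem_nhds hq)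
  -- `β` is weakly antiholomorphic, so `β ∘ conj` is weakly holomorphic; this provides the norm
  -- continuity of `β`.
  have hβ' : DifferentiableOn ℂ (fun q => β (conj q)) (conj ⁻¹' U) := by
    refine differentiableOn_of_inner (hU.preimage Complex.continuous_conj) fun φ p hp => ?_
    have h := ((hβ φ).differentiableAt (hU.mem_nhds hp)).conj_conj
    rw [Complex.conj_conj] at h
    exact (h.congr_of_eventuallyEq (Eventually.of_forall fun p =>
      (inner_conj_symm _ _).symm)).differentiableWithinAt
  have hc : ContinuousAt (fun q => β (conj q)) (conj q) :=
    (hβ'.differentiableAt ((hU.preimage Complex.continuous_conj).mem_nhds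
      (by simpa using hq))).continuousAt
  have hc' : ContinuousAt β q := by
    have := ContinuousAt.comp (f := (conj : ℂ → ℂ)) (x := q) hc Complex.continuous_conj.continuousAt
    simpa [Function.comp_def] using this
  exact (differentiableAt_inner_comp_conj hc'
    (fun φ => (hβ φ).differentiableAt (hU.mem_nhds hq)) hγ').differentiableWithinAt

variable {X : Type*} [NormedAddCommGroup X] [NormedSpace ℂ X]

theorem differentiableOn_conj_comp_line {g : X → ℂ} {B : Set X} (hB : IsOpen B)
    (hg : DifferentiableOn ℂ g B) (m d : X) :
    DifferentiableOn ℂ (fun q : ℂ => conj (g (m + conj q • d))) {q | m + conj q • d ∈ B} := by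
  intro q hq
  have h : DifferentiableAt ℂ (fun q : ℂ => g (m + q • d)) (conj q) :=
    DifferentiableAt.comp (conj q) (hg.differentiableAt (hB.mem_nhds hq)) (by fun_prop)
  have h' := h.conj_conj
  rw [Complex.conj_conj] at h'
  exact h'.differentiableWithinAt

theorem differentiableOn_comp_line {g : X → ℂ} {B : Set X}
    (hg : DifferentiableOn ℂ g B) (m d : X) :
    DifferentiableOn ℂ (fun q : ℂ => g (m + q • d)) {q | m + q • d ∈ B} :=
  hg.comp (f := fun q : ℂ => m + q • d) (by fun_prop) fun _ hq => hq

/-- If `β` and `γ` are weakly antiholomorphic, `⟪β z, γ w⟫` is holomorphic in `z` and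
antiholomorphic in `w`. -/
theorem differentiableOn_inner_line {β γ : X → V} {B : Set X} (hB : IsOpen B)
    (hβ : ∀ φ, DifferentiableOn ℂ (fun z => ⟪β z, φ⟫_ℂ) B)
    (hγ : ∀ φ, DifferentiableOn ℂ (fun z => ⟪γ z, φ⟫_ℂ) B) (m d : X) :
    DifferentiableOn ℂ (fun q : ℂ => ⟪β (m + q • d), γ (m + conj q • d)⟫_ℂ)
      {q | m + q • d ∈ B ∧ m + conj q • d ∈ B} := by
  refine differentiableOn_inner_of_weak ?_ (fun φ => ?_) fun φ => ?_
  · exact (hB.preimage (by fun_prop)).inter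
      (hB.preimage (by have := Complex.continuous_conj; fun_prop))
  · exact (differentiableOn_comp_line (hβ φ) m d).mono fun q hq => hq.1
  · refine ((differentiableOn_conj_comp_line hB (hγ φ) m d).mono fun q hq => hq.2).congr
      fun q _ => ?_
    rw [inner_conj_symm]

/-- If `β` and `γ` are weakly holomorphic, `⟪β w, γ z⟫` is holomorphic in `z` and
antiholomorphic in `w`. -/
theorem differentiableOn_inner_line' {β γ : X → V} {B : Set X} (hB : IsOpen B)
    (hβ : ∀ φ, DifferentiableOn ℂ (fun z => ⟪φ, β z⟫_ℂ) B)
    (hγ : ∀ φ, DifferentiableOn ℂ (fun z => ⟪φ, γ z⟫_ℂ) B) (m d : X) :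
    DifferentiableOn ℂ (fun q : ℂ => ⟪β (m + conj q • d), γ (m + q • d)⟫_ℂ)
      {q | m + q • d ∈ B ∧ m + conj q • d ∈ B} := by
  refine differentiableOn_inner_of_weak ?_ (fun φ => ?_) fun φ => ?_
  · exact (hB.preimage (by fun_prop)).inter
      (hB.preimage (by have := Complex.continuous_conj; fun_prop))
  · refine ((differentiableOn_conj_comp_line hB (hβ φ) m d).mono fun q hq => hq.2).congr
      fun q _ => ?_
    rw [inner_conj_symm]
  · exact (differentiableOn_comp_line (hγ φ) m d).mono fun q hq => hq.1

end Pairing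

/-! ### Conjugate-linear isometries and Schur's lemma -/

section ConjugateLinear

variable {V V' : Type*} [NormedAddCommGroup V] [InnerProductSpace ℂ V] [NormedAddCommGroup V']
  [InnerProductSpace ℂ V']

/-- A conjugate-linear isometry conjugates the inner product. -/
theorem inner_map_map_of_conjugateLinear (f : V →ₗ⋆[ℂ] V') (hf : ∀ v, ‖f v‖ = ‖v‖) (u v : V) :
    ⟪f u, f v⟫_ℂ = ⟪v, u⟫_ℂ := by
  have hI : Complex.I • f v = -f (Complex.I • v) := by
    rw [map_smulₛₗ, Complex.conj_I, neg_smul, neg_neg]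
  rw [← inner_conj_symm v u, inner_eq_sum_norm_sq_div_four, inner_eq_sum_norm_sq_div_four]
  simp only [RCLike.I_to_complex]
  rw [hI, sub_neg_eq_add, ← sub_eq_add_neg, ← map_add f, ← map_sub f, ← map_add f, ← map_sub f]
  simp only [hf]
  simp only [map_div₀, map_add, map_sub, map_mul, map_pow, Complex.conj_I, RCLike.conj_ofReal,
    map_ofNat]
  ring

end ConjugateLinear

section Schur

variable {G V ι : Type*} [Group G] [NormedAddCommGroup V] [InnerProductSpace ℂ V]

open ContinuousLinearMap in
theorem adjoint_intertwines [CompleteSpace V] (ρ : G →* (V ≃ₗᵢ[ℂ] V)) {A : V →L[ℂ] V}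
    (hA : ∀ (g : G) (v : V), A (ρ g v) = ρ g (A v)) (g : G) (v : V) :
    adjoint A (ρ g v) = ρ g (adjoint A v) := by
  refine ext_inner_right ℂ fun w => ?_
  have hw : w = ρ g (ρ g⁻¹ w) := by
    rw [map_inv]; exact ((ρ g).apply_symm_apply w).symm
  rw [hw, adjoint_inner_left, hA, LinearIsometryEquiv.inner_map_map,
    LinearIsometryEquiv.inner_map_map, adjoint_inner_left]

variable [DecidableEq ι] [FiniteDimensional ℂ V] {ρ : G →* (V ≃ₗᵢ[ℂ] V)} {W : ι → Submodule ℂ V}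

/-- In a multiplicity-free representation, an intertwining operator preserves each summand of an
irreducible decomposition. -/
theorem IsMultiplicityFree.mapsTo_of_intertwines (hρ : IsMultiplicityFree ρ)
    (hW : IsIrreducibleDecomposition ρ W) {M : V →L[ℂ] V}
    (hM : ∀ (g : G) (v : V), M (ρ g v) = ρ g (M v)) {i : ι} {v : V} (hv : v ∈ W i) :
    M v ∈ W i := by
  let := hW.isInternal.chooseDecomposition
  -- The projection onto `W i` along the other summands intertwines, so multiplicity-freeness makes
  -- it commute with `M`.
  let P : V →L[ℂ] V := LinearMap.toContinuousLinearMap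
    ((W i).subtype ∘ₗ DirectSum.component ℂ ι (fun i => W i) i ∘ₗ
      (DirectSum.decomposeLinearEquiv W).toLinearMap)
  have hPdef : ∀ v, P v = (DirectSum.decompose W v i : V) := fun v => rfl
  have hP : ∀ (g : G) (v : V), P (ρ g v) = ρ g (P v) := by
    intro g v
    induction v using DirectSum.Decomposition.inductionOn W with
    | zero => simp
    | @homogeneous j m =>
      have hm := hW.invariant j g m m.2
      by_cases hij : j = i
      · subst hij
        rw [hPdef, hPdef, DirectSum.decompose_of_mem_same W hm,
          DirectSum.decompose_of_mem_same W m.2]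
      · rw [hPdef, hPdef, DirectSum.decompose_of_mem_ne W hm hij,
          DirectSum.decompose_of_mem_ne W m.2 hij, map_zero]
    | add a b ha hb => simp [ha, hb]
  have h := congrArg (fun A : V →L[ℂ] V => A v) (hρ M P hM hP)
  simp only [mul_apply_eq_comp] at h
  rw [hPdef v, DirectSum.decompose_of_mem_same W hv] at h
  rw [h, hPdef]
  exact Subtype.property _

/-- Schur's lemma for multiplicity-free representations. -/
theorem IsMultiplicityFree.exists_smul_of_intertwines (hρ : IsMultiplicityFree ρ)
    (hW : IsIrreducibleDecomposition ρ W) {M : V →L[ℂ] V}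
    (hM : ∀ (g : G) (v : V), M (ρ g v) = ρ g (M v)) (i : ι) :
    ∃ c : ℂ, ∀ v ∈ W i, M v = c • v := by
  have hmaps : ∀ v ∈ W i, (M : V →ₗ[ℂ] V) v ∈ W i := fun v hv =>
    hρ.mapsTo_of_intertwines hW hM hv
  have : Nontrivial (W i) := Submodule.nontrivial_iff_ne_bot.2 (hW.ne_bot i)
  obtain ⟨c, hc⟩ := Module.End.exists_eigenvalue ((M : V →ₗ[ℂ] V).restrict hmaps)
  obtain ⟨w, hw⟩ := hc.exists_hasEigenvector
  have hw1 : M w = c • (w : V) := congrArg Subtype.val hw.apply_eq_smul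
  -- The eigenspace inside `W i` is invariant and nonzero, hence all of `W i`.
  let U : Submodule ℂ V := W i ⊓ LinearMap.ker ((M : V →ₗ[ℂ] V) - c • LinearMap.id)
  have hU : ∀ v, v ∈ U ↔ v ∈ W i ∧ M v = c • v := fun v => by
    simp [U, sub_eq_zero]
  rcases hW.irreducible i U inf_le_left (fun g v hv => by
    rw [hU] at hv ⊢
    exact ⟨hW.invariant i g v hv.1, by rw [hM, hv.2, map_smul]⟩) with h | h
  · have : (w : V) ∈ U := (hU _).2 ⟨w.2, hw1⟩
    rw [h, Submodule.mem_bot] at this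
    exact absurd (Subtype.ext this) hw.2
  · exact ⟨c, fun v hv => ((hU v).1 (h ▸ hv)).2⟩

open ContinuousLinearMap in
/-- A conjugate-linear map preserving the summands of an irreducible decomposition of a
multiplicity-free representation exchanges every intertwining operator with its adjoint. -/
theorem IsMultiplicityFree.conjugateLinear_comp (hρ : IsMultiplicityFree ρ)
    (hW : IsIrreducibleDecomposition ρ W) {M : V →L[ℂ] V}
    (hM : ∀ (g : G) (v : V), M (ρ g v) = ρ g (M v)) (f : V →ₗ⋆[ℂ] V)
    (hf : ∀ i, ∀ v ∈ W i, f v ∈ W i) (v : V) :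
    f (M v) = adjoint M (f v) := by
  have : CompleteSpace V := FiniteDimensional.complete ℂ V
  let := hW.isInternal.chooseDecomposition
  induction v using DirectSum.Decomposition.inductionOn W with
  | zero => simp
  | @homogeneous i m =>
    obtain ⟨c, hc⟩ := hρ.exists_smul_of_intertwines hW hM i
    obtain ⟨d, hd⟩ := hρ.exists_smul_of_intertwines hW (adjoint_intertwines ρ hM) i
    rcases eq_or_ne (m : V) 0 with h0 | h0
    · simp [h0]
    have hcd : d = conj c := by
      have h := adjoint_inner_right M (m : V) m
      rw [hd _ m.2, hc _ m.2, inner_smul_left, inner_smul_right] at h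
      exact mul_right_cancel₀ (inner_self_ne_zero.2 h0) h
    rw [hc _ m.2, map_smulₛₗ, hd _ (hf i _ m.2), hcd]
  | add a b ha hb => simp [ha, hb]

end Schur

/-! ### Kernel vectors and the kernel identity on the diagonal -/

section Kernel

variable {ED : Type*} [NormedAddCommGroup ED] [NormedSpace ℂ ED]
  {D : Type*} [TopologicalSpace D] [ChartedSpace ED D]
  {F : Type*} [NormedAddCommGroup F] [NormedSpace ℂ F]
  {E : D → Type*} [∀ x, NormedAddCommGroup (E x)] [∀ x, InnerProductSpace ℂ (E x)]
  [TopologicalSpace (TotalSpace F E)] [FiberBundle F E]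

/-- Evaluation is 1-Lipschitz for the uniform distance over the compact set `{x}`. -/
theorem HolSection.continuous_eval (x : D) : Continuous fun s : HolSection ED F E => s x := by
  have h : @Continuous _ _ (HolSection.edistOn ({x} : Set D)).toUniformSpace.toTopologicalSpace _
      fun s : HolSection ED F E => s x := by
    let := HolSection.edistOn (ED := ED) (F := F) (E := E) ({x} : Set D)
    refine LipschitzWith.continuous (K := 1) fun s t => ?_
    rw [ENNReal.coe_one, one_mul]
    exact le_iSup₂ (f := fun y (_ : y ∈ ({x} : Set D)) => edist (s y) (t y)) x rfl
  exact continuous_le_dom (iInf_le (fun K : {K : Set D // IsCompact K} =>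
    (HolSection.edistOn (ED := ED) (F := F) (E := E)
      (K : Set D)).toUniformSpace.toTopologicalSpace) ⟨{x}, isCompact_singleton⟩) h

variable [VectorBundle ℂ F E] {V : Type*} [NormedAddCommGroup V] [InnerProductSpace ℂ V]

/-- Evaluation at `x` of the sections belonging to a space continuously embedded in
`𝒪(D, E)`. -/
noncomputable def evalCLM (T : V →ₗ[ℂ] HolSection ED F E) (hT : Continuous T) (x : D) : V →L[ℂ] E x where
  toFun v := T v x
  map_add' u v := by rw [map_add]; rfl
  map_smul' c v := by rw [map_smul]; rfl
  cont := (HolSection.continuous_eval x).comp hT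

variable [CompleteSpace V]

/-- The vector of `V` representing the functional `φ ↦ ⟪p, T φ x⟫`, for `p` in the fiber over
`x`. -/
noncomputable def kernelVector (T : V →ₗ[ℂ] HolSection ED F E) (hT : Continuous T)
    (p : TotalSpace F E) : V :=
  (toDual ℂ V).symm ((innerSL ℂ p.snd).comp (evalCLM T hT p.proj))

theorem inner_kernelVector (T : V →ₗ[ℂ] HolSection ED F E) (hT : Continuous T)
    (p : TotalSpace F E) (φ : V) : ⟪kernelVector T hT p, φ⟫_ℂ = ⟪p.snd, T φ p.proj⟫_ℂ := by
  rw [kernelVector, toDual_symm_apply]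
  rfl

variable {H : Type*} [Group H] [TopologicalSpace H] [MulAction H D]
  {𝓛 : BundleAction ED F E H} {ρ : H →* (V ≃ₗᵢ[ℂ] V)}
  {T : V →ₗ[ℂ] HolSection ED F E} {hT : Continuous T}

theorem kernelVector_total
    (hTρ : ∀ (h : H) (v : V) (x : D), T (ρ h v) (h • x) = 𝓛.L h x (T v x))
    (h : H) (p : TotalSpace F E) :
    kernelVector T hT (𝓛.total h p) = ρ h (kernelVector T hT p) := by
  refine ext_inner_right ℂ fun φ => ?_
  obtain ⟨φ, rfl⟩ := (ρ h).surjective φ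
  rw [LinearIsometryEquiv.inner_map_map, inner_kernelVector, inner_kernelVector]
  change ⟪𝓛.L h p.proj p.snd, T (ρ h φ) (h • p.proj)⟫_ℂ = _
  rw [hTρ, LinearIsometryEquiv.inner_map_map]

theorem BundleAction.exists_total_eq (𝓛 : BundleAction ED F E H) {h : H} {x : D}
    {p : TotalSpace F E} (hp : h • x = p.proj) : ∃ u : E x, 𝓛.total h ⟨x, u⟩ = p := by
  obtain ⟨y, v⟩ := p
  obtain rfl : h • x = y := hp
  exact ⟨(𝓛.L h x).symm v, by simp [BundleAction.total]⟩

variable {S : Set D} {σ : OpenPartialHomeomorph D D} {τ : H ≃* H}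
  {f : ∀ x, E x →ₗ⋆[ℂ] E (σ x)}

theorem finiteDimensional_fiber (F : Type*) [NormedAddCommGroup F] [NormedSpace ℂ F]
    {E : D → Type*} [∀ x, NormedAddCommGroup (E x)] [∀ x, InnerProductSpace ℂ (E x)]
    [TopologicalSpace (TotalSpace F E)] [FiberBundle F E] [VectorBundle ℂ F E]
    [FiniteDimensional ℂ F] (x : D) : FiniteDimensional ℂ (E x) :=
  (VectorBundle.continuousLinearEquivAt ℂ F E x).symm.toLinearEquiv.finiteDimensional

theorem finrank_fiber (F : Type*) [NormedAddCommGroup F] [NormedSpace ℂ F]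
    {E : D → Type*} [∀ x, NormedAddCommGroup (E x)] [∀ x, InnerProductSpace ℂ (E x)]
    [TopologicalSpace (TotalSpace F E)] [FiberBundle F E] [VectorBundle ℂ F E] (x : D) :
    Module.finrank ℂ (E x) = Module.finrank ℂ F :=
  (VectorBundle.continuousLinearEquivAt ℂ F E x).toLinearEquiv.finrank_eq

open ContinuousLinearMap in
/-- Over `S`, the lift `f` conjugates the kernel of an intertwining operator on the diagonal. -/
theorem inner_kernelVector_lift_of_mem [FiniteDimensional ℂ F]
    (hTρ : ∀ (h : H) (v : V) (x : D), T (ρ h v) (h • x) = 𝓛.L h x (T v x))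
    {A : V →L[ℂ] V} (hA : ∀ (h : H) (v : V), A (ρ h v) = ρ h (A v))
    {x : D} (hσ : σ x = x) (hfib : IsMultiplicityFree (𝓛.isotropyRep x))
    {n : ℕ} {W : Fin n → Submodule ℂ (E x)}
    (hW : IsIrreducibleDecomposition (𝓛.isotropyRep x) W)
    (hf : ∀ v : E x, ‖f x v‖ = ‖v‖)
    (hfW : ∀ i : Fin n, (fun v : E x => TotalSpace.mk' F (σ x) (f x v)) '' (W i : Set (E x)) =
        TotalSpace.mk' F x '' (W i : Set (E x))) (u v : E x) :
    ⟪A (kernelVector T hT (BundleAction.liftTotal f ⟨x, u⟩)),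
      kernelVector T hT (BundleAction.liftTotal f ⟨x, v⟩)⟫_ℂ =
    ⟪A (kernelVector T hT ⟨x, v⟩), kernelVector T hT ⟨x, u⟩⟫_ℂ := by
  have := finiteDimensional_fiber F (E := E) x
  have : CompleteSpace (E x) := FiniteDimensional.complete ℂ _
  -- `f x` lands in the fiber over `σ x`; since `σ x = x`, transport makes it an endomorphism of `E
  -- x`.
  let g : E x →ₗ⋆[ℂ] E x :=
    ((fiberCast hσ : E (σ x) ≃ₗᵢ[ℂ] E x).toLinearEquiv : E (σ x) →ₗ[ℂ] E x).comp (f x)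
  have hgdef : ∀ w, g w = fiberCast hσ (f x w) := fun w => rfl
  have hg : ∀ w : E x, TotalSpace.mk' F x (g w) = BundleAction.liftTotal f ⟨x, w⟩ := fun w =>
    mk_fiberCast F hσ (f x w)
  have hgnorm : ∀ w, ‖g w‖ = ‖w‖ := fun w => by
    rw [hgdef, LinearIsometryEquiv.norm_map, hf]
  have hgW : ∀ i, ∀ w ∈ W i, g w ∈ W i := by
    intro i w hw
    have h1 : TotalSpace.mk' F x (g w) ∈ TotalSpace.mk' F x '' (W i : Set (E x)) := by
      rw [← hfW i]
      exact ⟨w, hw, (hg w).symm⟩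
    obtain ⟨w', hw', he⟩ := h1
    rwa [← TotalSpace.mk_injective x he]
  set Tx := evalCLM T hT x
  have hk : ∀ w : E x, kernelVector T hT ⟨x, w⟩ = adjoint Tx w := fun w =>
    ext_inner_right ℂ fun φ => by rw [inner_kernelVector, adjoint_inner_left]; rfl
  -- The kernel of `A` at `(x, x)`, as an operator on the fiber; it commutes with the isotropy
  -- group.
  let M : E x →L[ℂ] E x := Tx ∘L A ∘L adjoint Tx
  have hstab : ∀ (h : MulAction.stabilizer H x) (w : E x),
      TotalSpace.mk' F x (𝓛.isotropyRep x h w) = 𝓛.total h ⟨x, w⟩ := fun h w =>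
    mk_fiberCast F h.2 _
  have hadj : ∀ (h : MulAction.stabilizer H x) (w : E x),
      adjoint Tx (𝓛.isotropyRep x h w) = ρ h (adjoint Tx w) := by
    intro h w
    rw [← hk, ← hk, ← kernelVector_total hTρ]
    exact congrArg (kernelVector T hT) (hstab h w)
  have hM : ∀ (h : MulAction.stabilizer H x) (w : E x),
      M (𝓛.isotropyRep x h w) = 𝓛.isotropyRep x h (M w) := by
    intro h w
    refine ext_inner_left ℂ fun w' => ?_
    obtain ⟨w', rfl⟩ := (𝓛.isotropyRep x h).surjective w'
    rw [LinearIsometryEquiv.inner_map_map]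
    simp only [M, comp_apply]
    rw [← adjoint_inner_left, hadj, hadj, hA, LinearIsometryEquiv.inner_map_map,
      adjoint_inner_left]
  have key := hfib.conjugateLinear_comp hW hM g hgW
  rw [← hg, ← hg, hk, hk, hk, hk, adjoint_inner_right, adjoint_inner_right]
  change ⟪M (g u), g v⟫_ℂ = ⟪M v, u⟫_ℂ
  rw [← adjoint_inner_right, ← key, inner_map_map_of_conjugateLinear g hgnorm]

/-- The conjugation of the kernel of an intertwining operator on the diagonal, over `H · S`. -/
theorem inner_kernelVector_lift_of_proj_eq
    (hTρ : ∀ (h : H) (v : V) (x : D), T (ρ h v) (h • x) = 𝓛.L h x (T v x))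
    (hf : 𝓛.IsAntiholomorphicLift S σ τ f)
    {A : V →L[ℂ] V} (hA : ∀ (h : H) (v : V), A (ρ h v) = ρ h (A v))
    (hS : ∀ x ∈ S, ∀ u v : E x,
      ⟪A (kernelVector T hT (BundleAction.liftTotal f ⟨x, u⟩)),
        kernelVector T hT (BundleAction.liftTotal f ⟨x, v⟩)⟫_ℂ =
      ⟪A (kernelVector T hT ⟨x, v⟩), kernelVector T hT ⟨x, u⟩⟫_ℂ)
    {p q : TotalSpace F E} (hpq : p.proj = q.proj) (hp : p.proj ∈ orbitSet H S) :
    ⟪A (kernelVector T hT (BundleAction.liftTotal f p)),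
      kernelVector T hT (BundleAction.liftTotal f q)⟫_ℂ =
    ⟪A (kernelVector T hT q), kernelVector T hT p⟫_ℂ := by
  obtain ⟨h, x, hx, hxp⟩ := hp
  obtain ⟨u, rfl⟩ := 𝓛.exists_total_eq hxp
  obtain ⟨v, rfl⟩ := 𝓛.exists_total_eq (hxp.trans hpq)
  have hxS : x ∈ orbitSet H S := ⟨1, x, hx, one_smul H x⟩
  -- The left side is moved by `ρ (τ h)` and the right by `ρ h`; both are unitary and commute with
  -- `A`, so they drop out.
  rw [← hf.equivariant h ⟨x, u⟩ hxS, ← hf.equivariant h ⟨x, v⟩ hxS]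
  simp only [kernelVector_total hTρ, hA, LinearIsometryEquiv.inner_map_map]
  exact hS x hx u v

end Kernel

/-- Regarded over `ℝ`, this is an injective linear map between spaces of equal finite dimension. -/
theorem surjective_of_conjugateLinear_isometry {X Y : Type*} [NormedAddCommGroup X]
    [NormedSpace ℂ X] [NormedAddCommGroup Y] [NormedSpace ℂ Y] [FiniteDimensional ℂ X]
    [FiniteDimensional ℂ Y] (h : Module.finrank ℂ X = Module.finrank ℂ Y) (f : X →ₗ⋆[ℂ] Y)
    (hf : ∀ v, ‖f v‖ = ‖v‖) : Function.Surjective f := by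
  have := FiniteDimensional.complexToReal X
  have := FiniteDimensional.complexToReal Y
  let g : X →ₗ[ℝ] Y :=
    { toFun := f
      map_add' := map_add f
      map_smul' := fun t v => by
        rw [← Complex.coe_smul, map_smulₛₗ, Complex.conj_ofReal, Complex.coe_smul]; rfl }
  have hg : Function.Injective g := (injective_iff_map_eq_zero g).2 fun v hv => by
    rw [← norm_eq_zero, ← hf]
    exact norm_eq_zero.2 hv
  exact (LinearMap.injective_iff_surjective_of_finrank_eq_finrank (f := g) (by
    rw [finrank_real_of_complex, finrank_real_of_complex, h])).1 hg

/-! ### The involved inverse identities for `σ` on `H · S` -/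

section Visible

variable {ED : Type*} [NormedAddCommGroup ED] [NormedSpace ℂ ED]
  {D : Type*} [TopologicalSpace D] [ChartedSpace ED D]
  {H : Type*} [Group H] [MulAction H D] {S : Set D} {σ : OpenPartialHomeomorph D D}

theorem IsSVisible.symm_mem (hvis : IsSVisible (ED := ED) H S σ) {y : D}
    (hy : y ∈ orbitSet H S) : σ.symm y ∈ orbitSet H S :=
  hvis.source_eq ▸ σ.map_target (hvis.target_eq ▸ hy)

theorem IsSVisible.apply_symm (hvis : IsSVisible (ED := ED) H S σ) {y : D}
    (hy : y ∈ orbitSet H S) : σ (σ.symm y) = y :=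
  σ.right_inv (hvis.target_eq ▸ hy)

theorem IsSVisible.symm_apply (hvis : IsSVisible (ED := ED) H S σ) {x : D}
    (hx : x ∈ orbitSet H S) : σ.symm (σ x) = x :=
  σ.left_inv (hvis.source_eq ▸ hx)

end Visible

/-! ### Extension of the kernel identity off the diagonal, and totality -/

section OffDiagonal

variable {ED : Type*} [NormedAddCommGroup ED] [NormedSpace ℂ ED]
  {D : Type*} [TopologicalSpace D] [ChartedSpace ED D]
  {F : Type*} [NormedAddCommGroup F] [NormedSpace ℂ F]
  {E : D → Type*} [∀ x, NormedAddCommGroup (E x)] [∀ x, InnerProductSpace ℂ (E x)]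
  [TopologicalSpace (TotalSpace F E)] [FiberBundle F E] [VectorBundle ℂ F E]
  {V : Type*} [NormedAddCommGroup V] [InnerProductSpace ℂ V] [CompleteSpace V]
  {H : Type*} [Group H] [TopologicalSpace H] [MulAction H D]
  {𝓛 : BundleAction ED F E H}
  {T : V →ₗ[ℂ] HolSection ED F E} {hT : Continuous T}
  {S : Set D} {σ : OpenPartialHomeomorph D D} {τ : H ≃* H}
  {f : ∀ x, E x →ₗ⋆[ℂ] E (σ x)}

theorem surjective_lift [FiniteDimensional ℂ F] (hf : 𝓛.IsAntiholomorphicLift S σ τ f) {x : D} (hx : x ∈ orbitSet H S) :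
    Function.Surjective (f x) := by
  have := finiteDimensional_fiber F (E := E) x
  have := finiteDimensional_fiber F (E := E) (σ x)
  exact surjective_of_conjugateLinear_isometry
    ((finrank_fiber F x).trans (finrank_fiber F (σ x)).symm) _ (hf.isometric x hx)

/-- The point `p` of the bundle lies over `σ⁻¹ y`, where `y` has coordinate `z` in the chart at
`y₀`, and pairing with `f p` is the functional `η` in the trivialization at `y₀`. -/
def Represents (f : ∀ x, E x →ₗ⋆[ℂ] E (σ x)) (y₀ : D) (η : F →L[ℂ] ℂ) (z : ED)
    (p : TotalSpace F E) : Prop :=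
  p.proj = σ.symm ((chartAt ED y₀).symm z) ∧
    ∀ v : E (σ p.proj), ⟪f p.proj p.snd, v⟫_ℂ =
      η (trivializationAt F E y₀ (TotalSpace.mk' F (σ p.proj) v)).2

/-- Riesz representation in the fiber over `σ x`, followed by surjectivity of `f x`. -/
theorem exists_represents [FiniteDimensional ℂ F] (hvis : IsSVisible (ED := ED) H S σ)
    (hf : 𝓛.IsAntiholomorphicLift S σ τ f) (y₀ : D) (η : F →L[ℂ] ℂ) {z : ED}
    (hz : z ∈ coordinateDomain (ED := ED) F E y₀)
    (hzS : (chartAt ED y₀).symm z ∈ orbitSet H S) : ∃ p, Represents f y₀ η z p := by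
  set x := σ.symm ((chartAt ED y₀).symm z) with hx
  have hσx : σ x = (chartAt ED y₀).symm z := hvis.apply_symm hzS
  have hb : σ x ∈ (trivializationAt F E y₀).baseSet := hσx ▸ hz.2
  have := finiteDimensional_fiber F (E := E) (σ x)
  have : CompleteSpace (E (σ x)) := FiniteDimensional.complete ℂ _
  obtain ⟨u, hu⟩ := surjective_lift hf (hvis.symm_mem hzS) ((toDual ℂ (E (σ x))).symm
    (η.comp ((trivializationAt F E y₀).continuousLinearEquivAt ℂ (σ x) hb : E (σ x) →L[ℂ] F)))
  refine ⟨⟨x, u⟩, rfl, fun v => ?_⟩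
  change ⟪f x u, v⟫_ℂ = _
  rw [hu, toDual_symm_apply]
  rfl

/-- Allows a single given point to be placed in a family with constant functional `η`, along which
the kernel vectors vary holomorphically or antiholomorphically. -/
theorem exists_functional (y₀ : D) {p : TotalSpace F E}
    (hp : p.proj = σ.symm (σ p.proj)) (hs : σ p.proj ∈ (chartAt ED y₀).source)
    (hb : σ p.proj ∈ (trivializationAt F E y₀).baseSet) :
    ∃ η : F →L[ℂ] ℂ, Represents f y₀ η (chartAt ED y₀ (σ p.proj)) p := by
  refine ⟨(innerSL ℂ (f p.proj p.snd)).comp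
    (((trivializationAt F E y₀).continuousLinearEquivAt ℂ (σ p.proj) hb).symm :
      F →L[ℂ] E (σ p.proj)), ?_, fun v => ?_⟩
  · rw [(chartAt ED y₀).left_inv hs]; exact hp
  · have h := ((trivializationAt F E y₀).continuousLinearEquivAt ℂ (σ p.proj) hb).symm_apply_apply v
    conv_lhs => rw [← h]
    rfl

section Formulas

variable {y₀ : D} {η : F →L[ℂ] ℂ} {z : ED} {p : TotalSpace F E}

theorem Represents.apply_proj (hvis : IsSVisible (ED := ED) H S σ)
    (hp : Represents f y₀ η z p) (hzS : (chartAt ED y₀).symm z ∈ orbitSet H S) :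
    σ p.proj = (chartAt ED y₀).symm z := by
  rw [hp.1, hvis.apply_symm hzS]

theorem Represents.inner_kernelVector_lift (hvis : IsSVisible (ED := ED) H S σ)
    (hp : Represents f y₀ η z p) (hzS : (chartAt ED y₀).symm z ∈ orbitSet H S) (φ : V) :
    ⟪kernelVector T hT (BundleAction.liftTotal f p), φ⟫_ℂ =
      η (inCoordinates y₀ (fun x => TotalSpace.mk' F x (T φ x)) z) := by
  rw [inner_kernelVector, inCoordinates, ← hp.apply_proj hvis hzS]
  exact hp.2 _

theorem Represents.inner_kernelVector_right (hvis : IsSVisible (ED := ED) H S σ)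
    (hf : 𝓛.IsAntiholomorphicLift S σ τ f)
    (hp : Represents f y₀ η z p) (hzS : (chartAt ED y₀).symm z ∈ orbitSet H S) (φ : V) :
    ⟪φ, kernelVector T hT p⟫_ℂ =
      η (inCoordinates y₀ (fun y => BundleAction.liftTotal f
        (TotalSpace.mk' F (σ.symm y) (T φ (σ.symm y)))) z) := by
  have hpS : p.proj ∈ orbitSet H S := hp.1 ▸ hvis.symm_mem hzS
  rw [← inner_conj_symm, inner_kernelVector, inner_conj_symm,
    ← inner_map_map_of_conjugateLinear (f p.proj) (hf.isometric _ hpS), hp.2, inCoordinates,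
    ← hp.1]
  rfl

end Formulas

variable [IsManifold 𝓘(ℂ, ED) ω D] [ContMDiffVectorBundle ω F E 𝓘(ℂ, ED)]

theorem differentiableOn_inner_kernelVector_lift (hvis : IsSVisible (ED := ED) H S σ)
    {y₀ : D} {η : F →L[ℂ] ℂ} {B : Set ED} (hB : B ⊆ coordinateDomain (ED := ED) F E y₀)
    (hBS : ∀ z ∈ B, (chartAt ED y₀).symm z ∈ orbitSet H S) {P : ED → TotalSpace F E}
    (hP : ∀ z ∈ B, Represents f y₀ η z (P z)) (φ : V) :
    DifferentiableOn ℂ (fun z => ⟪kernelVector T hT (BundleAction.liftTotal f (P z)), φ⟫_ℂ) B := by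
  have h : DifferentiableOn ℂ
      (fun z => η (inCoordinates y₀ (fun x => TotalSpace.mk' F x (T φ x)) z)) B :=
    η.differentiable.comp_differentiableOn
      ((analyticOnNhd_inCoordinates (T φ) y₀).mono hB).differentiableOn
  exact h.congr fun z hz => (hP z hz).inner_kernelVector_lift hvis (hBS z hz) φ

/-- The pairing is `η` applied to the coordinates of `f ∘ T φ ∘ σ⁻¹`, in which two antiholomorphic
maps compose to a holomorphic one. -/
theorem differentiableOn_inner_kernelVector_right (hvis : IsSVisible (ED := ED) H S σ)
    (hf : 𝓛.IsAntiholomorphicLift S σ τ f)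
    {y₀ : D} {η : F →L[ℂ] ℂ} {B : Set ED} (hB : B ⊆ coordinateDomain (ED := ED) F E y₀)
    (hBS : ∀ z ∈ B, (chartAt ED y₀).symm z ∈ orbitSet H S) {P : ED → TotalSpace F E}
    (hP : ∀ z ∈ B, Represents f y₀ η z (P z)) (φ : V) :
    DifferentiableOn ℂ (fun z => ⟪φ, kernelVector T hT (P z)⟫_ℂ) B := by
  have h : DifferentiableOn ℂ (fun z => η (inCoordinates y₀ (fun y => BundleAction.liftTotal f
        (TotalSpace.mk' F (σ.symm y) (T φ (σ.symm y)))) z)) B := by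
    refine η.differentiable.comp_differentiableOn fun z hz => ?_
    refine (differentiableAt_inCoordinates_antiholomorphic (T φ) y₀ hf.antiholomorphic
      hvis.antiholomorphic_symm (hB hz).1 (hBS z hz) (hvis.symm_mem (hBS z hz))
      ?_).differentiableWithinAt
    change σ (σ.symm _) ∈ _
    rw [hvis.apply_symm (hBS z hz)]
    exact (hB hz).2
  exact h.congr fun z hz => (hP z hz).inner_kernelVector_right hvis hf (hBS z hz) φ

open ContinuousLinearMap in
/-- The conjugation of the kernel of an operator extends from the diagonal to a neighbourhood. -/
theorem inner_kernelVector_lift_of_mem_ball [FiniteDimensional ℂ F]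
    (hvis : IsSVisible (ED := ED) H S σ)
    (hf : 𝓛.IsAntiholomorphicLift S σ τ f) {A : V →L[ℂ] V}
    (hdiag : ∀ p q : TotalSpace F E, p.proj = q.proj → p.proj ∈ orbitSet H S →
      ⟪A (kernelVector T hT (BundleAction.liftTotal f p)),
        kernelVector T hT (BundleAction.liftTotal f q)⟫_ℂ =
      ⟪A (kernelVector T hT q), kernelVector T hT p⟫_ℂ)
    {y₀ : D} {z₀ : ED} {r : ℝ} (hr : 0 ≤ r)
    (hB : Metric.ball z₀ (3 * r) ⊆ coordinateDomain (ED := ED) F E y₀)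
    (hBS : ∀ z ∈ Metric.ball z₀ (3 * r), (chartAt ED y₀).symm z ∈ orbitSet H S)
    {p q : TotalSpace F E} (hpS : p.proj ∈ orbitSet H S) (hqS : q.proj ∈ orbitSet H S)
    (hps : σ p.proj ∈ (chartAt ED y₀).source) (hqs : σ q.proj ∈ (chartAt ED y₀).source)
    (hpb : chartAt ED y₀ (σ p.proj) ∈ Metric.ball z₀ r)
    (hqb : chartAt ED y₀ (σ q.proj) ∈ Metric.ball z₀ r) :
    ⟪A (kernelVector T hT (BundleAction.liftTotal f p)),
      kernelVector T hT (BundleAction.liftTotal f q)⟫_ℂ =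
    ⟪A (kernelVector T hT q), kernelVector T hT p⟫_ℂ := by
  have hsub : Metric.ball z₀ r ⊆ Metric.ball z₀ (3 * r) :=
    Metric.ball_subset_ball (by linarith)
  have hbase : ∀ x, σ x ∈ (chartAt ED y₀).source → chartAt ED y₀ (σ x) ∈ Metric.ball z₀ r →
      σ x ∈ (trivializationAt F E y₀).baseSet := fun x hx hxb => by
    have := (hB (hsub hxb)).2
    rwa [Set.mem_preimage, (chartAt ED y₀).left_inv hx] at this
  obtain ⟨η, hη⟩ := exists_functional (f := f) (ED := ED) y₀ (hvis.symm_apply hpS).symm hps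
    (hbase _ hps hpb)
  obtain ⟨θ, hθ⟩ := exists_functional (f := f) (ED := ED) y₀ (hvis.symm_apply hqS).symm hqs
    (hbase _ hqs hqb)
  have : Nonempty (TotalSpace F E) := ⟨p⟩
  choose! P hP using fun z (hz : z ∈ Metric.ball z₀ (3 * r)) =>
    exists_represents hvis hf y₀ η (hB hz) (hBS z hz)
  choose! Q hQ using fun z (hz : z ∈ Metric.ball z₀ (3 * r)) =>
    exists_represents hvis hf y₀ θ (hB hz) (hBS z hz)
  -- The families `P` and `Q` are arbitrary choices, but the kernel vectors depend only on the
  -- functional and on `z`, so `p` and `q` may be replaced by members of the families.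
  have hvec : ∀ {ζ : F →L[ℂ] ℂ} {z : ED} {p p' : TotalSpace F E}, z ∈ Metric.ball z₀ (3 * r) →
      Represents f y₀ ζ z p → Represents f y₀ ζ z p' →
      kernelVector T hT p = kernelVector T hT p' ∧
        kernelVector T hT (BundleAction.liftTotal f p) =
          kernelVector T hT (BundleAction.liftTotal f p') := by
    intro ζ z p p' hz hp hp'
    refine ⟨ext_inner_left ℂ fun φ => ?_, ext_inner_right ℂ fun φ => ?_⟩
    · rw [hp.inner_kernelVector_right hvis hf (hBS z hz),
        hp'.inner_kernelVector_right hvis hf (hBS z hz)]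
    · rw [hp.inner_kernelVector_lift hvis (hBS z hz), hp'.inner_kernelVector_lift hvis (hBS z hz)]
  have hp1 := hvec (hsub hpb) hη (hP _ (hsub hpb))
  have hq1 := hvec (hsub hqb) hθ (hQ _ (hsub hqb))
  rw [hp1.1, hp1.2, hq1.1, hq1.2, ← sub_eq_zero]
  refine eq_zero_of_eq_zero_on_diagonal (z₀ := z₀) (r := r)
    (k := fun z w => ⟪A (kernelVector T hT (BundleAction.liftTotal f (P z))),
      kernelVector T hT (BundleAction.liftTotal f (Q w))⟫_ℂ -
      ⟪A (kernelVector T hT (Q w)), kernelVector T hT (P z)⟫_ℂ) (fun m d => ?_) (fun z hz => ?_)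
    hpb hqb
  · refine (differentiableOn_inner_line
      (β := fun z => A (kernelVector T hT (BundleAction.liftTotal f (P z))))
      (γ := fun z => kernelVector T hT (BundleAction.liftTotal f (Q z)))
      Metric.isOpen_ball (fun φ => ?_) (fun φ => ?_) m d).sub
      (differentiableOn_inner_line' (β := fun z => A (kernelVector T hT (Q z)))
        (γ := fun z => kernelVector T hT (P z))
        Metric.isOpen_ball (fun φ => ?_) (fun φ => ?_) m d)
    · exact (differentiableOn_inner_kernelVector_lift hvis hB hBS hP (adjoint A φ)).congr
        fun z _ => (adjoint_inner_right A _ _).symm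
    · exact differentiableOn_inner_kernelVector_lift hvis hB hBS hQ φ
    · exact (differentiableOn_inner_kernelVector_right hvis hf hB hBS hQ (adjoint A φ)).congr
        fun z _ => (adjoint_inner_left A _ _).symm
    · exact differentiableOn_inner_kernelVector_right hvis hf hB hBS hP φ
  · refine sub_eq_zero.2 (hdiag _ _ ((hP z hz).1.trans (hQ z hz).1.symm) ?_)
    rw [(hP z hz).1]
    exact hvis.symm_mem (hBS z hz)

/-- The kernel vectors over a nonempty open set are total. -/
theorem dense_span_kernelVector [ConnectedSpace D] (hinj : Function.Injective T) {ι : Type*}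
    (P : ι → TotalSpace F E) {U : Set D} (hU : IsOpen U) (hne : U.Nonempty)
    (hP : ∀ x ∈ U, ∀ v : E x, ∃ i, P i = ⟨x, v⟩) :
    Dense (Submodule.span ℂ (Set.range fun i => kernelVector T hT (P i)) : Set V) := by
  rw [Submodule.dense_iff_topologicalClosure_eq_top, Submodule.topologicalClosure_eq_top_iff,
    Submodule.eq_bot_iff]
  intro φ hφ
  refine (injective_iff_map_eq_zero T).1 hinj φ
    (HolSection.eq_zero_of_eqOn_open (T φ) hU hne fun x hx => ?_)
  -- A vector `φ` orthogonal to all kernel vectors is tested against the fiber vector `T φ x`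
  -- itself, giving `⟪T φ x, T φ x⟫ = 0`.
  obtain ⟨i, hi⟩ := hP x hx (T φ x)
  have h := (Submodule.mem_orthogonal _ _).1 hφ _ (Submodule.subset_span ⟨i, rfl⟩)
  rw [inner_kernelVector, hi] at h
  exact inner_self_eq_zero.1 h

end OffDiagonal

/-! ### Assembly of the theorem -/

/-- Let `E → D` be an `H`-equivariant Hermitian holomorphic vector bundle over a connected complex
manifold. Assume that the `H`-action on `D` is `S`-visible (by means of `σ`) with a compatible
automorphism `τ` of `H`, that `H_x` acts multiplicity-freely on `E x` for `x ∈ S`, with irreducible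
decomposition `E x = ⨁ i, W x i`, and that `σ` lifts to an anti-holomorphic endomorphism `f` of the
`H`-equivariant bundle such that `f x (W x i) = W x i` for `x ∈ S`. Then every unitary
representation of `H` realized in `𝒪(D, E)` is multiplicity-free. -/
theorem theorem4p3
    -- the Lie group `H`
    {EH : Type*} [NormedAddCommGroup EH] [NormedSpace ℝ EH] [FiniteDimensional ℝ EH]
    {H : Type*} [Group H] [TopologicalSpace H] [ChartedSpace EH H] [LieGroup 𝓘(ℝ, EH) ∞ H]
    -- the connected complex manifold `D`
    {ED : Type*} [NormedAddCommGroup ED] [NormedSpace ℂ ED] [FiniteDimensional ℂ ED]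
    {D : Type*} [TopologicalSpace D] [T2Space D] [ConnectedSpace D] [ChartedSpace ED D]
    [IsManifold 𝓘(ℂ, ED) ω D]
    -- the Hermitian holomorphic vector bundle `E → D` with model fiber `F`
    {F : Type*} [NormedAddCommGroup F] [NormedSpace ℂ F] [FiniteDimensional ℂ F]
    {E : D → Type*} [∀ x, NormedAddCommGroup (E x)] [∀ x, InnerProductSpace ℂ (E x)]
    [TopologicalSpace (TotalSpace F E)] [FiberBundle F E] [VectorBundle ℂ F E]
    [ContMDiffVectorBundle ω F E 𝓘(ℂ, ED)] (hE : IsSmoothHermitian ED F E)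
    -- the action of `H`
    [MulAction H D] (𝓛 : BundleAction ED F E H)
    -- base space
    (S : Set D) (hS : S.Nonempty) (σ : OpenPartialHomeomorph D D)
    (hvis : IsSVisible (ED := ED) H S σ)
    (τ : H ≃* H) (hτ : IsCompatibleAut S σ τ)
    -- fiber
    (hfib : ∀ x ∈ S, IsMultiplicityFree (𝓛.isotropyRep x))
    (n : D → ℕ) (W : ∀ x : D, Fin (n x) → Submodule ℂ (E x))
    (hW : ∀ x ∈ S, IsIrreducibleDecomposition (𝓛.isotropyRep x) (W x))
    -- compatibility
    (f : ∀ x, E x →ₗ⋆[ℂ] E (σ x)) (hf : 𝓛.IsAntiholomorphicLift S σ τ f)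
    (hfW : ∀ x ∈ S, ∀ i : Fin (n x),
      (fun v : E x => TotalSpace.mk' F (σ x) (f x v)) '' (W x i : Set (E x)) =
        TotalSpace.mk' F x '' (W x i : Set (E x)))
    -- a unitary representation realized in `𝒪(D, E)`
    {V : Type*} [NormedAddCommGroup V] [InnerProductSpace ℂ V] [CompleteSpace V]
    (ρ : UnitaryRep H V) (hρ : 𝓛.IsRealized ρ) :
    IsMultiplicityFree ρ.toHom := by
  obtain ⟨T, hinj, hT, hTρ⟩ := hρ
  intro A B hA hB
  let R : Set (V →L[ℂ] V) := {A | ∀ (h : H) (v : V), A (ρ.toHom h v) = ρ.toHom h (A v)}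
  obtain ⟨y₀, hy₀⟩ := hS
  have hy₀S : y₀ ∈ orbitSet H S := ⟨1, y₀, hy₀, one_smul H y₀⟩
  set c := chartAt ED y₀
  have hopen : IsOpen (coordinateDomain (ED := ED) F E y₀ ∩
      (c.target ∩ c.symm ⁻¹' orbitSet H S)) :=
    (isOpen_coordinateDomain y₀).inter (c.isOpen_inter_preimage_symm hvis.isOpen)
  have hcy₀ : c.symm (c y₀) = y₀ := c.left_inv (mem_chart_source ED y₀)
  obtain ⟨ε, hε, hball⟩ := Metric.isOpen_iff.1 hopen (c y₀)
    ⟨mem_coordinateDomain y₀, mem_chart_target ED y₀, by rwa [Set.mem_preimage, hcy₀]⟩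
  -- Extension off the diagonal on a ball of radius `r` needs room `3r`.
  obtain ⟨r, hr, rfl⟩ : ∃ r : ℝ, 0 < r ∧ 3 * r = ε := ⟨ε / 3, by positivity, by ring⟩
  let U : Set D := (c.source ∩ c ⁻¹' Metric.ball (c y₀) r) ∩ orbitSet H S
  have hU : IsOpen U := (c.isOpen_inter_preimage Metric.isOpen_ball).inter hvis.isOpen
  have hyU : y₀ ∈ U := ⟨⟨mem_chart_source ED y₀, Metric.mem_ball_self hr⟩, hy₀S⟩
  -- The points `p` fill the bundle over the open set `σ⁻¹ U`, and by surjectivity of the fiber maps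
  -- the points `f p` fill it over `U`; both families of kernel vectors are therefore total.
  let ι := {p : TotalSpace F E // p.proj ∈ orbitSet H S ∧ σ p.proj ∈ U}
  refine mul_comm_of_total_families (ι := ι) (R := R)
    (a := fun i => kernelVector T hT i.1)
    (b := fun i => kernelVector T hT (BundleAction.liftTotal f i.1)) ?_ ?_
    (fun _ _ => rfl) (fun A hA B hB h v => ?_) (fun A hA i j => ?_) hA hB
  · refine dense_span_kernelVector hinj _ (U := σ.source ∩ σ ⁻¹' U)
      (σ.isOpen_inter_preimage hU) ⟨y₀, ?_, ?_⟩ fun x hx v => ?_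
    · rwa [hvis.source_eq]
    · rwa [Set.mem_preimage, hvis.fixes y₀ hy₀]
    · exact ⟨⟨⟨x, v⟩, hvis.source_eq ▸ hx.1, hx.2⟩, rfl⟩
  · refine dense_span_kernelVector hinj (fun i : ι => BundleAction.liftTotal f i.1) hU
      ⟨y₀, hyU⟩ fun y hy w => ?_
    obtain ⟨x, hx, rfl⟩ : ∃ x ∈ orbitSet H S, σ x = y :=
      ⟨_, hvis.symm_mem hy.2, hvis.apply_symm hy.2⟩
    obtain ⟨u, rfl⟩ := surjective_lift hf hx w
    exact ⟨⟨⟨x, u⟩, hx, hy⟩, rfl⟩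
  · change A (B _) = _
    rw [hB, hA]; rfl
  · rw [ContinuousLinearMap.adjoint_inner_right]
    refine inner_kernelVector_lift_of_mem_ball hvis hf (fun p q hpq hp => ?_) hr.le
      (fun z hz => (hball hz).1) (fun z hz => (hball hz).2.2) i.2.1 j.2.1 i.2.2.1.1 j.2.2.1.1
      i.2.2.1.2 j.2.2.1.2
    refine inner_kernelVector_lift_of_proj_eq hTρ hf hA (fun x hx u v => ?_) hpq hp
    exact inner_kernelVector_lift_of_mem hTρ hA (hvis.fixes x hx) (hfib x hx) (hW x hx)
      (hf.isometric x ⟨1, x, hx, one_smul H x⟩) (hfW x hx) u v
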